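/- Let $\Lambda>0$, $a,m_e,\omega\in\mathbb R$ and $k\in\mathbb R\setminus(-1,0)$ (for instance $k\in\mathbb Z$). Put $\widehat k=k+\tfrac12$, $\Xi=1+\tfrac{\Lambda a^2}{3}$ and $\Delta_\vartheta=1+\tfrac{\Lambda a^2}{3}\cos^2\vartheta$. Let $x(\vartheta)=\int_0^\vartheta \frac{dt}{\sqrt{\Delta_t}}$ for $\vartheta\in[0,\pi]$, let $x_2=x(\pi)$ and $I=(0,x_2)$, and let $x\mapsto\vartheta(x)$ be the inverse function of $\vartheta\mapsto x(\vartheta)$. Consider the formal differential expression \[ \mathcal U=\begin{pmatrix} -am_e\cos\vartheta(x) & \dfrac{d}{dx}-\dfrac{\Xi}{\sqrt{\Delta_{\vartheta(x)}}}\Big[a\omega\sin\vartheta(x)+\dfrac{\widehat k}{\sin\vartheta(x)}\Big]\\[2mm] -\dfrac{d}{dx}-\dfrac{\Xi}{\sqrt{\Delta_{\vartheta(x)}}}\Big[a\omega\sin\vartheta(x)+\dfrac{\widehat k}{\sin\vartheta(x)}\Big] & am_e\cos\vartheta(x) \end{pmatrix} \] on $I$, and let $A$ be the operator $AS=\mathcal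 US$ in the Hilbert space $L^2(I,dx)^2$ with domain \[ D(A)=\{S\in L^2(I,dx)^2 : S \text{ is absolutely continuous on each compact subinterval of } I,\ \mathcal US\in L^2(I,dx)^2\}. \] Then the angular operator $A$ is self-adjoint and has compact resolvent, that is, its resolvent set $\rho(A)$ is non-empty and $(A-z)^{-1}$ is a compact operator for every $z\in\rho(A)$. Consequently, the spectrum of $A$ consists only of isolated eigenvalues, and it has no finite accumulation point. -/

import Mathlib

open Set Filter Topology MeasureTheory

noncomputable section

/-! ### Unbounded operators: resolvent set, spectrum, eigenvalues, compact resolvent -/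

namespace UnboundedOperator

variable {H : Type*} [NormedAddCommGroup H] [InnerProductSpace ℂ H]

/-- `R` is the bounded two-sided inverse `(T - z)⁻¹ : H → D(T)` of `T - z : D(T) → H`. -/
def IsResolventAt (T : H →ₗ.[ℂ] H) (z : ℂ) (R : H →L[ℂ] H) : Prop :=
  (∀ u : T.domain, R (T u - z • (u : H)) = u) ∧
    ∀ v : H, ∃ u : T.domain, (u : H) = R v ∧ T u - z • (u : H) = v

/-- The resolvent set `ρ(T)`. -/
def resolventSet (T : H →ₗ.[ℂ] H) : Set ℂ :=
  {z | ∃ R : H →L[ℂ] H, IsResolventAt T z R}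

/-- The spectrum `σ(T) = ℂ \ ρ(T)`. -/
def spectrum (T : H →ₗ.[ℂ] H) : Set ℂ := (resolventSet T)ᶜ

/-- `z` is an eigenvalue of `T`. -/
def IsEigenvalue (T : H →ₗ.[ℂ] H) (z : ℂ) : Prop :=
  ∃ u : T.domain, (u : H) ≠ 0 ∧ T u = z • (u : H)

/-- `T` has compact resolvent: `ρ(T)` is non-empty and `(T - z)⁻¹` is a compact operator for
every `z ∈ ρ(T)`. -/
def HasCompactResolvent (T : H →ₗ.[ℂ] H) : Prop :=
  (resolventSet T).Nonempty ∧
    ∀ (z : ℂ) (R : H →L[ℂ] H), IsResolventAt T z R → IsCompactOperator R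

end UnboundedOperator

/-! ### The angular operator of the Dirac equation in the Kerr-de Sitter metric -/

namespace KerrDeSitter

/-- `σ = Λ a² / 3`. -/
def sig (Λ a : ℝ) : ℝ := Λ * a ^ 2 / 3

/-- `Ξ = 1 + Λ a² / 3`. -/
def Xi (Λ a : ℝ) : ℝ := 1 + sig Λ a

/-- `Δ_θ = 1 + (Λ a² / 3) cos² θ`. -/
def Delta (Λ a θ : ℝ) : ℝ := 1 + sig Λ a * Real.cos θ ^ 2

/-- The new variable `x(θ) = ∫_0^θ dt / √Δ_t`. -/
def xOf (Λ a θ : ℝ) : ℝ := ∫ t in (0 : ℝ)..θ, 1 / Real.sqrt (Delta Λ a t)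

/-- The length `x₂ = x(π)` of the interval `I = (0, x₂)`. -/
def len (Λ a : ℝ) : ℝ := xOf Λ a Real.pi

/-- The inverse function `θ(x)` of `x(θ)`, from `[0, x₂]` to `[0, π]`. -/
def angle (Λ a x : ℝ) : ℝ := Function.invFunOn (xOf Λ a) (Icc 0 Real.pi) x

theorem Delta_pos {Λ : ℝ} (hΛ : 0 < Λ) (a θ : ℝ) : 0 < Delta Λ a θ := by
  unfold Delta sig
  positivity

theorem continuous_integrand {Λ : ℝ} (hΛ : 0 < Λ) (a : ℝ) :
    Continuous fun t => 1 / Real.sqrt (Delta Λ a t) := by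
  have h : Continuous fun t => Delta Λ a t := by unfold Delta; fun_prop
  exact continuous_const.div (Real.continuous_sqrt.comp h)
    fun t => (Real.sqrt_pos.2 (Delta_pos hΛ a t)).ne'

theorem hasDerivAt_xOf {Λ : ℝ} (hΛ : 0 < Λ) (a θ : ℝ) :
    HasDerivAt (xOf Λ a) (1 / Real.sqrt (Delta Λ a θ)) θ :=
  (continuous_integrand hΛ a).integral_hasStrictDerivAt 0 θ |>.hasDerivAt

theorem strictMono_xOf {Λ : ℝ} (hΛ : 0 < Λ) (a : ℝ) : StrictMono (xOf Λ a) := by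
  refine strictMono_of_deriv_pos fun θ => ?_
  rw [(hasDerivAt_xOf hΛ a θ).deriv]
  exact one_div_pos.2 (Real.sqrt_pos.2 (Delta_pos hΛ a θ))

theorem angle_spec {Λ : ℝ} (hΛ : 0 < Λ) (a : ℝ) {x : ℝ} (hx : x ∈ Icc 0 (len Λ a)) :
    angle Λ a x ∈ Icc 0 Real.pi ∧ xOf Λ a (angle Λ a x) = x := by
  have h0 : xOf Λ a 0 = 0 := by simp [xOf]
  have hc : ContinuousOn (xOf Λ a) (Icc 0 Real.pi) :=
    fun θ _ => (hasDerivAt_xOf hΛ a θ).continuousAt.continuousWithinAt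
  have him : x ∈ xOf Λ a '' Icc 0 Real.pi :=
    intermediate_value_Icc Real.pi_pos.le hc (by rw [h0]; exact hx)
  exact ⟨Function.invFunOn_mem him, Function.invFunOn_eq him⟩

theorem angle_xOf {Λ : ℝ} (hΛ : 0 < Λ) (a : ℝ) {θ : ℝ} (hθ : θ ∈ Icc 0 Real.pi) :
    angle Λ a (xOf Λ a θ) = θ :=
  (strictMono_xOf hΛ a).injective.injOn.leftInvOn_invFunOn hθ

/-- The off-diagonal coefficient
`(Ξ / √Δ) [a ω sin θ + k̂ / sin θ]` at `θ = θ(x)`, where `k̂ = k + 1/2`. -/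
def offDiag (Λ a ω k x : ℝ) : ℝ :=
  Xi Λ a / Real.sqrt (Delta Λ a (angle Λ a x)) *
    (a * ω * Real.sin (angle Λ a x) + (k + 1 / 2) / Real.sin (angle Λ a x))

/-- The diagonal coefficient `a m cos θ` at `θ = θ(x)`. -/
def diag (Λ a m x : ℝ) : ℝ := a * m * Real.cos (angle Λ a x)

/-- First component of the formal expression `𝒰 (f, g)`:
`- a m cos θ(x) f + (d/dx - (Ξ / √Δ) [a ω sin θ + k̂ / sin θ]) g`. -/
def formal₁ (Λ a m ω k : ℝ) (f g : ℝ → ℂ) (x : ℝ) : ℂ :=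
  -(diag Λ a m x : ℂ) * f x + (deriv g x - (offDiag Λ a ω k x : ℂ) * g x)

/-- Second component of the formal expression `𝒰 (f, g)`:
`(- d/dx - (Ξ / √Δ) [a ω sin θ + k̂ / sin θ]) f + a m cos θ(x) g`. -/
def formal₂ (Λ a m ω k : ℝ) (f g : ℝ → ℂ) (x : ℝ) : ℂ :=
  (-deriv f x - (offDiag Λ a ω k x : ℂ) * f x) + (diag Λ a m x : ℂ) * g x

/-- `f` is (locally) absolutely continuous on the open interval `(0, L)`: it is absolutely
continuous on each compact subinterval. -/
def IsLocAC (L : ℝ) (f : ℝ → ℂ) : Prop :=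
  ∀ c d : ℝ, 0 < c → c ≤ d → d < L → AbsolutelyContinuousOnInterval f c d

/-- Lebesgue measure on `I = (0, L)`. -/
abbrev measureI (L : ℝ) : Measure ℝ := (volume : Measure ℝ).restrict (Ioo 0 L)

/-- The Hilbert space `L²(I, dx)²`, `I = (0, L)`. -/
abbrev L2Pair (L : ℝ) : Type :=
  WithLp 2 (Lp ℂ 2 (measureI L) × Lp ℂ 2 (measureI L))

/-- `S ∈ L²(I)²` is absolutely continuous (that is, has the absolutely continuous representative
`(f, g)`) and `𝒰 S = T` almost everywhere, with `T ∈ L²(I)²`. -/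
def IsAngularPair (Λ a m ω k : ℝ) (S T : L2Pair (len Λ a)) : Prop :=
  ∃ f g : ℝ → ℂ, IsLocAC (len Λ a) f ∧ IsLocAC (len Λ a) g ∧
    S.fst =ᵐ[measureI (len Λ a)] f ∧ S.snd =ᵐ[measureI (len Λ a)] g ∧
    T.fst =ᵐ[measureI (len Λ a)] formal₁ Λ a m ω k f g ∧
    T.snd =ᵐ[measureI (len Λ a)] formal₂ Λ a m ω k f g

theorem IsLocAC.ae_differentiableAt {L : ℝ} {f : ℝ → ℂ} (hf : IsLocAC L f) :
    ∀ᵐ x ∂measureI L, DifferentiableAt ℝ f x := by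
  have key : ∀ n : ℕ, ∀ᵐ x ∂(volume : Measure ℝ),
      x ∈ Ioo (1 / ((n : ℝ) + 1)) (L - 1 / ((n : ℝ) + 1)) → DifferentiableAt ℝ f x := by
    intro n
    by_cases h : 1 / ((n : ℝ) + 1) ≤ L - 1 / ((n : ℝ) + 1)
    · have hn : (0 : ℝ) < 1 / ((n : ℝ) + 1) := by positivity
      have hac := hf _ _ hn h (by linarith)
      filter_upwards [hac.boundedVariationOn.ae_differentiableAt_of_mem_uIcc] with x hx hxI
      exact hx (by rw [uIcc_of_le h]; exact Ioo_subset_Icc_self hxI)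
    · filter_upwards with x hx
      exact absurd (hx.1.trans hx.2).le h
  rw [ae_restrict_iff' measurableSet_Ioo]
  filter_upwards [ae_all_iff.2 key] with x hx hxI
  obtain ⟨n, hn⟩ := exists_nat_one_div_lt (lt_min hxI.1 (sub_pos.2 hxI.2))
  rw [lt_min_iff] at hn
  exact hx n ⟨hn.1, by linarith [hn.2]⟩

theorem IsLocAC.zero (L : ℝ) : IsLocAC L 0 := fun _ _ _ _ _ =>
  (contDiff_const (c := (0 : ℂ))).contDiffOn.absolutelyContinuousOnInterval

theorem IsLocAC.add {L : ℝ} {f g : ℝ → ℂ} (hf : IsLocAC L f) (hg : IsLocAC L g) :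
    IsLocAC L (f + g) := fun c d h0 h1 h2 => (hf c d h0 h1 h2).add (hg c d h0 h1 h2)

theorem IsLocAC.const_smul {L : ℝ} {f : ℝ → ℂ} (r : ℂ) (hf : IsLocAC L f) :
    IsLocAC L (r • f) := fun c d h0 h1 h2 => (hf c d h0 h1 h2).const_smul r

theorem IsLocAC.continuousOn {L : ℝ} {f : ℝ → ℂ} (hf : IsLocAC L f) :
    ContinuousOn f (Ioo 0 L) := by
  intro x hx
  have h1 : (0 : ℝ) < x / 2 := by linarith [hx.1]
  have h2 : x / 2 ≤ (x + L) / 2 := by linarith [hx.1, hx.2]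
  have h := (hf (x / 2) ((x + L) / 2) h1 h2 (by linarith [hx.2])).continuousOn
  rw [uIcc_of_le h2] at h
  exact (h.continuousAt (Icc_mem_nhds (by linarith [hx.1]) (by linarith [hx.2]))).continuousWithinAt

/-- The absolutely continuous representative is unique on the open interval. -/
theorem IsLocAC.eqOn_of_ae {L : ℝ} {f g : ℝ → ℂ} (hf : IsLocAC L f) (hg : IsLocAC L g)
    (h : f =ᵐ[measureI L] g) : EqOn f g (Ioo 0 L) :=
  Measure.eqOn_open_of_ae_eq h isOpen_Ioo hf.continuousOn hg.continuousOn

/-- The graph of the angular operator. -/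
def angularGraph (Λ a m ω k : ℝ) : Submodule ℂ (L2Pair (len Λ a) × L2Pair (len Λ a)) where
  carrier := {p | IsAngularPair Λ a m ω k p.1 p.2}
  zero_mem' := by
    have h0 : IsLocAC (len Λ a) 0 := IsLocAC.zero _
    have hz : ∀ᵐ x ∂measureI (len Λ a), (0 : Lp ℂ 2 (measureI (len Λ a))) x = 0 :=
      Lp.coeFn_zero ℂ 2 (measureI (len Λ a))
    have hd : deriv (0 : ℝ → ℂ) = 0 := by ext x; exact deriv_const x (0 : ℂ)
    refine ⟨0, 0, h0, h0, hz, hz, ?_, ?_⟩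
    · filter_upwards [hz] with x hx
      exact hx.trans (by simp [formal₁, hd])
    · filter_upwards [hz] with x hx
      exact hx.trans (by simp [formal₂, hd])
  add_mem' := by
    rintro ⟨S, T⟩ ⟨S', T'⟩ ⟨f, g, hf, hg, h1, h2, h3, h4⟩ ⟨f', g', hf', hg', h1', h2', h3', h4'⟩
    refine ⟨f + f', g + g', hf.add hf', hg.add hg', ?_, ?_, ?_, ?_⟩
    · exact (Lp.coeFn_add S.fst S'.fst).trans (h1.add h1')
    · exact (Lp.coeFn_add S.snd S'.snd).trans (h2.add h2')
    · filter_upwards [Lp.coeFn_add T.fst T'.fst, h3, h3', hg.ae_differentiableAt,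
        hg'.ae_differentiableAt] with x e e1 e2 d1 d2
      refine e.trans ?_
      simp only [Pi.add_apply, e1, e2, formal₁, deriv_add d1 d2]
      ring
    · filter_upwards [Lp.coeFn_add T.snd T'.snd, h4, h4', hf.ae_differentiableAt,
        hf'.ae_differentiableAt] with x e e1 e2 d1 d2
      refine e.trans ?_
      simp only [Pi.add_apply, e1, e2, formal₂, deriv_add d1 d2]
      ring
  smul_mem' := by
    rintro r ⟨S, T⟩ ⟨f, g, hf, hg, h1, h2, h3, h4⟩
    refine ⟨r • f, r • g, hf.const_smul r, hg.const_smul r, ?_, ?_, ?_, ?_⟩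
    · exact (Lp.coeFn_smul r S.fst).trans (h1.const_smul r)
    · exact (Lp.coeFn_smul r S.snd).trans (h2.const_smul r)
    · filter_upwards [Lp.coeFn_smul r T.fst, h3, hg.ae_differentiableAt] with x e e1 d1
      refine e.trans ?_
      simp only [Pi.smul_apply, e1, formal₁, deriv_const_smul r d1, smul_eq_mul]
      ring
    · filter_upwards [Lp.coeFn_smul r T.snd, h4, hf.ae_differentiableAt] with x e e1 d1
      refine e.trans ?_
      simp only [Pi.smul_apply, e1, formal₂, deriv_const_smul r d1, smul_eq_mul]
      ring

/-- `𝒰 S` does not depend on the choice of the representative. -/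
theorem angularGraph_functional (Λ a m ω k : ℝ) :
    ∀ p ∈ angularGraph Λ a m ω k, p.1 = 0 → p.2 = 0 := by
  rintro ⟨S, T⟩ ⟨f, g, hf, hg, h1, h2, h3, h4⟩ hS
  obtain rfl : S = 0 := hS
  have h0 : IsLocAC (len Λ a) 0 := IsLocAC.zero _
  have hz : (0 : Lp ℂ 2 (measureI (len Λ a))) =ᵐ[measureI (len Λ a)] (0 : ℝ → ℂ) :=
    Lp.coeFn_zero ℂ 2 (measureI (len Λ a))
  have ef := hf.eqOn_of_ae h0 (h1.symm.trans hz)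
  have eg := hg.eqOn_of_ae h0 (h2.symm.trans hz)
  have dz : ∀ {u : ℝ → ℂ}, EqOn u 0 (Ioo 0 (len Λ a)) →
      ∀ x ∈ Ioo 0 (len Λ a), deriv u x = 0 := by
    intro u hu x hx
    rw [(hu.eventuallyEq_of_mem (isOpen_Ioo.mem_nhds hx)).deriv_eq]
    exact deriv_const x (0 : ℂ)
  have hI : ∀ᵐ x ∂measureI (len Λ a), x ∈ Ioo 0 (len Λ a) := ae_restrict_mem measurableSet_Ioo
  have t1 : T.fst = 0 := by
    refine Lp.ext (h3.trans (EventuallyEq.trans ?_ hz.symm))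
    filter_upwards [hI] with x hx
    simp [formal₁, dz eg x hx, ef hx, eg hx]
  have t2 : T.snd = 0 := by
    refine Lp.ext (h4.trans (EventuallyEq.trans ?_ hz.symm))
    filter_upwards [hI] with x hx
    simp [formal₂, dz ef x hx, ef hx, eg hx]
  exact WithLp.ofLp_injective 2 (Prod.ext t1 t2)

/-- The angular operator `A S = 𝒰 S` in `L²(I, dx)²`, with domain the `S ∈ L²(I, dx)²` that are
absolutely continuous with `𝒰 S ∈ L²(I, dx)²`. -/
def angularOperator (Λ a m ω k : ℝ) : L2Pair (len Λ a) →ₗ.[ℂ] L2Pair (len Λ a) :=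
  (angularGraph Λ a m ω k).toLinearPMap

theorem angularOperator_graph (Λ a m ω k : ℝ) :
    (angularOperator Λ a m ω k).graph = angularGraph Λ a m ω k :=
  Submodule.toLinearPMap_graph_eq _ (angularGraph_functional Λ a m ω k)

/-- The domain of the angular operator. -/
theorem mem_domain_angularOperator (Λ a m ω k : ℝ) (S : L2Pair (len Λ a)) :
    S ∈ (angularOperator Λ a m ω k).domain ↔ ∃ T, IsAngularPair Λ a m ω k S T := by
  rw [LinearPMap.mem_domain_iff, angularOperator_graph]
  rfl

/-- The action of the angular operator. -/
theorem angularOperator_apply (Λ a m ω k : ℝ) (S : (angularOperator Λ a m ω k).domain) :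
    IsAngularPair Λ a m ω k S (angularOperator Λ a m ω k S) := by
  have h := (angularOperator Λ a m ω k).mem_graph S
  rw [angularOperator_graph] at h
  exact h

end KerrDeSitter

end

/-! Write `p` for the off-diagonal coefficient and `d = a m cos θ`. For `S = (f, g)`, the equation
`𝒰 S = T` splits into `g' - p g = T₁ + d f` and `f' + p f = -(T₂ - d g)`. As `d` is bounded, `A` is
a bounded self-adjoint perturbation of its off-diagonal part, and it suffices that the latter is the
inverse of a compact self-adjoint operator `R`.

The condition on `k` makes the off-diagonal part limit point at both ends, so no boundary conditions
are needed. If `k ≥ 0`, then `p ≥ 1/(2x) - C` and `p ≥ 1/(2(L-x)) - C`. With `P' = p`, the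
homogeneous solutions satisfy `exp(-P)² ≥ const/x` near `0` and `exp(P)² ≥ const/(L-x)` near `L`, so
neither is square integrable (`not_memLp_exp_neg`, `not_memLp_exp`). Each scalar equation thus has
at most one solution in `L²`. Variation of constants supplies it, with kernel `-exp(P x - P y)` on
`x < y`; this is bounded because `p ≥ -C`, hence Hilbert-Schmidt on a bounded interval
(`exists_compact_inverse`). If `K` solves the equation for `g`, then `-K†` solves the one for `f`,
so `R` has off-diagonal blocks `K†` and `K`. The case `k ≤ -1` follows by changing the sign of `p`.

The rest is abstract (`IsPerturbedInverse`): the Fredholm alternative for `R (z - B)` identifies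
spectrum and eigenvalues, symmetry makes eigenvalues real and eigenvectors orthogonal, and
compactness of `R` allows only finitely many eigenvalues in a disc. -/

noncomputable section

/-! ### Spectral theory of `R⁻¹ + B` with `R` compact and `R`, `B` self-adjoint. -/

namespace UnboundedOperator

variable {H : Type*} [NormedAddCommGroup H] [InnerProductSpace ℂ H]

/-- `A = R⁻¹ + B`, expressed through graphs. -/
def IsPerturbedInverse (A : H →ₗ.[ℂ] H) (R B : H →L[ℂ] H) : Prop :=
  ∀ S T : H, (S, T) ∈ A.graph ↔ S = R (T - B S)

namespace IsPerturbedInverse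

variable {A : H →ₗ.[ℂ] H} {R B : H →L[ℂ] H}

theorem apply_eq (h : IsPerturbedInverse A R B) (u : A.domain) :
    (u : H) = R (A u - B u) :=
  (h _ _).1 (A.mem_graph u)

theorem exists_domain (h : IsPerturbedInverse A R B) {S T : H} (hS : S = R (T - B S)) :
    ∃ u : A.domain, (u : H) = S ∧ A u = T := by
  simpa using (LinearPMap.mem_graph_iff A).1 ((h S T).2 hS)

/-- `R` is injective because the graph of `A` is single-valued over `0`. -/
theorem eq_zero_of_apply_eq_zero (h : IsPerturbedInverse A R B) {w : H} (hw : R w = 0) : w = 0 :=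
  A.graph_fst_eq_zero_snd ((h 0 w).2 (by simp [hw])) rfl

/-- The eigenvalue equation for `A`. -/
theorem isEigenvalue_iff (h : IsPerturbedInverse A R B) (z : ℂ) :
    IsEigenvalue A z ↔ ∃ S : H, S ≠ 0 ∧ S = R (z • S - B S) := by
  constructor
  · rintro ⟨u, hu, e⟩
    exact ⟨u, hu, by rw [← e]; exact h.apply_eq u⟩
  · rintro ⟨S, hS, e⟩
    obtain ⟨u, rfl, e'⟩ := h.exists_domain e
    exact ⟨u, hS, e'⟩

theorem not_mem_resolventSet_of_isEigenvalue {A : H →ₗ.[ℂ] H} {z : ℂ} (hz : IsEigenvalue A z) :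
    z ∉ resolventSet A := by
  rintro ⟨Q, hQ, -⟩
  obtain ⟨u, hu, e⟩ := hz
  have := hQ u
  rw [e, sub_self, map_zero] at this
  exact hu this.symm

/-- The resolvent identity `Q = R (1 + (z - B) Q)` exhibits `Q` as a compact operator times a
bounded one. -/
theorem isCompactOperator_of_isResolventAt (h : IsPerturbedInverse A R B)
    (hR : IsCompactOperator R) {z : ℂ} {Q : H →L[ℂ] H} (hQ : IsResolventAt A z Q) :
    IsCompactOperator Q := by
  have : Q = R ∘L (1 + (z • 1 - B) ∘L Q) := by
    ext v
    obtain ⟨u, hu, e⟩ := hQ.2 v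
    have e' := h.apply_eq u
    rw [hu] at e e'
    change Q v = R (v + (z • Q v - B (Q v)))
    conv_lhs => rw [e']
    congr 1
    rw [sub_eq_iff_eq_add] at e
    rw [e]
    abel
  rw [this]
  exact hR.comp_clm _

variable [CompleteSpace H]

/-- The domain contains the range of `R`, whose orthogonal complement is the kernel of the
self-adjoint `R`, hence zero. -/
theorem dense_domain (h : IsPerturbedInverse A R B) (hR : IsSelfAdjoint R) :
    Dense (A.domain : Set H) := by
  rw [Submodule.dense_iff_topologicalClosure_eq_top, Submodule.topologicalClosure_eq_top_iff,
    Submodule.eq_bot_iff]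
  intro x hx
  refine h.eq_zero_of_apply_eq_zero (ext_inner_left ℂ fun w => ?_)
  -- This choice of `T` makes `T - B S = w`.
  obtain ⟨u, hu, -⟩ := h.exists_domain (S := R w) (T := w + B (R w)) (by simp)
  have h0 := hx (R w) (hu ▸ u.2)
  rw [inner_zero_right, ← h0]
  exact (hR.isSymmetric w x).symm

/-- Testing the adjoint relation against the graph points `(R w, w + B R w)`, for arbitrary `w`,
returns the equation `S = R (T - B S)` of the graph of `A`; the converse is symmetry of `R` and `B`.
-/
theorem isSelfAdjoint (h : IsPerturbedInverse A R B) (hR : IsSelfAdjoint R)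
    (hB : IsSelfAdjoint B) : IsSelfAdjoint A := by
  rw [LinearPMap.isSelfAdjoint_def]
  apply LinearPMap.eq_of_eq_graph
  rw [LinearPMap.adjoint_graph_eq_graph_adjoint (h.dense_domain hR)]
  ext ⟨S, T⟩
  rw [Submodule.mem_adjoint_iff, h]
  have hR' : ∀ x y : H, inner ℂ (R x) y = inner ℂ x (R y) := hR.isSymmetric
  have hB' : ∀ x y : H, inner ℂ (B x) y = inner ℂ x (B y) := hB.isSymmetric
  constructor
  · intro hS
    refine ext_inner_left ℂ fun w => ?_
    have := hS (R w) (w + B (R w)) ((h _ _).2 (by simp))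
    rw [← hR', inner_sub_right, ← hB']
    rw [inner_add_left] at this
    linear_combination this
  · intro hS a b hab
    have hab' := (h a b).1 hab
    have e1 : inner ℂ b S = inner ℂ (b - B a) S + inner ℂ a (B S) := by
      rw [inner_sub_left, hB']; ring
    have e2 : inner ℂ (b - B a) S = inner ℂ a (T - B S) := by
      conv_lhs => rw [hS]
      rw [← hR', ← hab']
    rw [e1, e2, inner_sub_right]
    ring

/-- The Fredholm alternative: a point which is not an eigenvalue is in the resolvent set. -/
theorem isEigenvalue_or_mem_resolventSet (h : IsPerturbedInverse A R B) (hR : IsCompactOperator R)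
    (z : ℂ) : IsEigenvalue A z ∨ z ∈ resolventSet A := by
  -- `A u = z u` means `C u = u`, and otherwise the resolvent is `(1 - C)⁻¹ R`. The Fredholm
  -- alternative for `C` at `1` separates the two cases.
  set C : H →L[ℂ] H := R ∘L (z • 1 - B) with hC
  have hCc : IsCompactOperator C := hR.comp_clm _
  rcases hCc.hasEigenvalue_or_mem_resolventSet (one_ne_zero (α := ℂ)) with h1 | h1
  · left
    obtain ⟨S, hS⟩ := h1.exists_hasEigenvector
    refine (h.isEigenvalue_iff z).2 ⟨S, hS.2, ?_⟩
    simpa [hC] using hS.apply_eq_smul.symm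
  · right
    rw [_root_.spectrum.mem_resolventSet_iff] at h1
    obtain ⟨V, hV⟩ := h1
    have hVC : ∀ x : H, (V : H →L[ℂ] H) x = x - R (z • x - B x) := fun x => by simp [hV, hC]
    have hV1 : ∀ x : H, (↑V⁻¹ : H →L[ℂ] H) ((V : H →L[ℂ] H) x) = x := fun x => by
      rw [← mul_apply_eq_comp, V.inv_mul, one_apply_eq_self]
    have hV2 : ∀ x : H, (V : H →L[ℂ] H) ((↑V⁻¹ : H →L[ℂ] H) x) = x := fun x => by
      rw [← mul_apply_eq_comp, V.mul_inv, one_apply_eq_self]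
    refine ⟨(↑V⁻¹ : H →L[ℂ] H) ∘L R, fun u => ?_, fun v => ?_⟩
    · have e : R (A u - z • (u : H)) = (V : H →L[ℂ] H) u := by
        have e1 : A u - z • (u : H) = (A u - B u) - (z • (u : H) - B u) := by abel
        rw [hVC, e1, map_sub, ← h.apply_eq u]
      rw [ContinuousLinearMap.comp_apply, e, hV1]
    · set S := (↑V⁻¹ : H →L[ℂ] H) (R v) with hS
      have e : S - R (z • S - B S) = R v := by rw [← hVC, hV2]
      obtain ⟨u, hu, hu'⟩ := h.exists_domain (S := S) (T := v + z • S) (by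
        rw [add_sub_assoc, map_add, ← e]; abel)
      exact ⟨u, hu, by rw [hu, hu']; abel⟩

/-- For `S = S'` and `z = z'` this gives real eigenvalues; for distinct eigenvalues it then gives
orthogonal eigenvectors. -/
theorem sub_star_mul_inner_eq_zero (_h : IsPerturbedInverse A R B) (hR : IsSelfAdjoint R)
    (hB : IsSelfAdjoint B) {S S' : H} {z z' : ℂ} (hS : S = R (z • S - B S))
    (hS' : S' = R (z' • S' - B S')) : (z' - star z) * inner ℂ S S' = 0 := by
  have hR' : ∀ x y : H, inner ℂ (R x) y = inner ℂ x (R y) := hR.isSymmetric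
  have hB' : ∀ x y : H, inner ℂ (B x) y = inner ℂ x (B y) := hB.isSymmetric
  have e : inner ℂ (z • S - B S) S' = inner ℂ S (z' • S' - B S') := by
    conv_lhs => rw [hS']
    rw [← hR', ← hS]
  rw [inner_sub_left, inner_sub_right, hB', inner_smul_left, inner_smul_right] at e
  linear_combination (norm := (simp; try ring)) -e

theorem star_eq_of_isEigenvalue (h : IsPerturbedInverse A R B) (hR : IsSelfAdjoint R)
    (hB : IsSelfAdjoint B) {z : ℂ} (hz : IsEigenvalue A z) : star z = z := by
  obtain ⟨S, hS0, hS⟩ := (h.isEigenvalue_iff z).1 hz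
  have := h.sub_star_mul_inner_eq_zero hR hB hS hS
  rw [mul_eq_zero, or_iff_left (inner_self_ne_zero.2 hS0), sub_eq_zero] at this
  exact this.symm

theorem mem_spectrum_iff (h : IsPerturbedInverse A R B) (hR : IsCompactOperator R) (z : ℂ) :
    z ∈ spectrum A ↔ IsEigenvalue A z :=
  ⟨fun hz => (h.isEigenvalue_or_mem_resolventSet hR z).resolve_right hz,
    not_mem_resolventSet_of_isEigenvalue⟩

theorem hasCompactResolvent (h : IsPerturbedInverse A R B) (hRc : IsCompactOperator R)
    (hR : IsSelfAdjoint R) (hB : IsSelfAdjoint B) : HasCompactResolvent A := by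
  -- Eigenvalues are real, so `I` is in the resolvent set.
  refine ⟨⟨Complex.I, (h.isEigenvalue_or_mem_resolventSet hRc _).resolve_left fun hz => ?_⟩,
    fun z Q hQ => h.isCompactOperator_of_isResolventAt hRc hQ⟩
  have := congrArg Complex.im (h.star_eq_of_isEigenvalue hR hB hz)
  norm_num at this

/-- Infinitely many eigenvalues in a disc would give an orthonormal sequence inside the compact
closure of the `R`-image of a ball, and such a sequence has no Cauchy subsequence. -/
theorem finite_spectrum_inter_closedBall (h : IsPerturbedInverse A R B)
    (hRc : IsCompactOperator R) (hR : IsSelfAdjoint R) (hB : IsSelfAdjoint B) (r : ℝ) :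
    (spectrum A ∩ Metric.closedBall 0 r).Finite := by
  by_contra hinf
  rw [← Set.Infinite] at hinf
  have hex : ∀ z : ↥(spectrum A ∩ Metric.closedBall (0 : ℂ) r),
      ∃ S : H, ‖S‖ = 1 ∧ S = R ((z : ℂ) • S - B S) := by
    rintro ⟨z, hz, -⟩
    obtain ⟨S, hS0, hS⟩ := (h.isEigenvalue_iff z).1 ((h.mem_spectrum_iff hRc z).1 hz)
    refine ⟨((‖S‖ : ℂ)⁻¹) • S, ?_, ?_⟩
    · rw [norm_smul, norm_inv, Complex.norm_real, norm_norm, inv_mul_cancel₀ (norm_ne_zero_iff.2 hS0)]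
    · rw [map_smul, smul_comm z, ← smul_sub, map_smul, ← hS]
  choose e he1 he2 using hex
  have horth : ∀ z z', z ≠ z' → inner ℂ (e z) (e z') = 0 := by
    intro z z' hzz
    have h1 := h.sub_star_mul_inner_eq_zero hR hB (he2 z) (he2 z')
    rw [h.star_eq_of_isEigenvalue hR hB ((h.mem_spectrum_iff hRc _).1 z.2.1)] at h1
    refine (mul_eq_zero.1 h1).resolve_left (sub_ne_zero.2 fun h2 => hzz (Subtype.ext h2.symm))
  have hdist : ∀ z z', z ≠ z' → 1 ≤ ‖e z - e z'‖ := by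
    intro z z' hzz
    have h1 : ‖e z - e z'‖ * ‖e z - e z'‖ = ‖e z‖ * ‖e z‖ + ‖e z'‖ * ‖e z'‖ :=
      by
      rw [norm_sub_mul_self (𝕜 := ℂ), horth z z' hzz]; simp
    rw [he1, he1] at h1
    nlinarith [norm_nonneg (e z - e z')]
  -- A unit eigenvector is `R (z e - B e)`, whose argument has norm at most `|r| + ‖B‖`; the
  -- absolute value covers negative `r`.
  obtain ⟨K, hK, hKsub⟩ := IsCompactOperator.image_closedBall_subset_compact
    (f := (R : H →ₗ[ℂ] H)) hRc (|r| + ‖B‖)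
  have hmem : ∀ z, e z ∈ K := by
    intro z
    refine hKsub ⟨(z : ℂ) • e z - B (e z), ?_, (he2 z).symm⟩
    rw [mem_closedBall_zero_iff]
    have hz : ‖(z : ℂ)‖ ≤ |r| := (mem_closedBall_zero_iff.1 z.2.2).trans (le_abs_self r)
    calc _ ≤ ‖(z : ℂ) • e z‖ + ‖B (e z)‖ := norm_sub_le _ _
      _ ≤ |r| * 1 + ‖B‖ * 1 := by
        refine add_le_add ?_ ?_
        · rw [norm_smul, he1]; gcongr
        · exact (B.le_opNorm _).trans (by rw [he1])
      _ = _ := by ring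
  have := hinf.to_subtype
  let s : ℕ ↪ ↥(spectrum A ∩ Metric.closedBall (0 : ℂ) r) := Infinite.natEmbedding _
  obtain ⟨y, -, ψ, hψ, hlim⟩ := hK.tendsto_subseq (x := fun n => e (s n)) fun n => hmem _
  obtain ⟨N, hN⟩ := Metric.cauchySeq_iff'.1 hlim.cauchySeq 1 one_pos
  have h1 := hN (N + 1) (Nat.le_succ N)
  rw [dist_eq_norm] at h1
  refine absurd h1 (not_lt.2 (hdist _ _ fun h2 => ?_))
  exact absurd (hψ.injective (s.injective h2)) (Nat.succ_ne_self N)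

theorem not_accPt_spectrum (h : IsPerturbedInverse A R B)
    (hRc : IsCompactOperator R) (hR : IsSelfAdjoint R) (hB : IsSelfAdjoint B) (z : ℂ) :
    ¬ AccPt z (𝓟 (spectrum A)) := by
  intro hz
  have hU : Metric.closedBall (0 : ℂ) (‖z‖ + 1) ∈ 𝓝 z := by
    refine mem_of_superset (Metric.ball_mem_nhds z one_pos) fun w hw => ?_
    rw [mem_closedBall_zero_iff]
    have : ‖w - z‖ < 1 := mem_ball_iff_norm.1 hw
    linarith [norm_le_norm_add_norm_sub z w, norm_sub_rev z w]
  have h1 := hz.nhds_inter hU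
  rw [inter_comm] at h1
  exact (Set.Infinite.of_accPt h1)
    (h.finite_spectrum_inter_closedBall hRc hR hB _)

theorem exists_nhds_inter_spectrum (h : IsPerturbedInverse A R B)
    (hRc : IsCompactOperator R) (hR : IsSelfAdjoint R) (hB : IsSelfAdjoint B) {z : ℂ}
    (hz : z ∈ spectrum A) : ∃ U ∈ 𝓝 z, U ∩ spectrum A = {z} := by
  have h1 := h.not_accPt_spectrum hRc hR hB z
  rw [accPt_iff_nhds] at h1
  push Not at h1
  obtain ⟨U, hU, h2⟩ := h1
  exact ⟨U, hU, Subset.antisymm (fun w hw => h2 w hw)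
    (singleton_subset_iff.2 ⟨mem_of_mem_nhds hU, hz⟩)⟩

end IsPerturbedInverse

end UnboundedOperator

/-! ### Compactness of Hilbert-Schmidt operators. -/

section HilbertSchmidt

variable {H F ι : Type*} [NormedAddCommGroup H] [InnerProductSpace ℂ H]
  [NormedAddCommGroup F] [NormedSpace ℂ F]

/-- The finite rank operator which agrees with `K` on the basis vectors indexed by `s` and vanishes
on the other ones. -/
def HilbertBasis.truncate (b : HilbertBasis ι ℂ H) (K : H →L[ℂ] F) (s : Finset ι) : H →L[ℂ] F :=
  ∑ i ∈ s, (innerSL ℂ (b i)).smulRight (K (b i))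

theorem HilbertBasis.truncate_apply (b : HilbertBasis ι ℂ H) (K : H →L[ℂ] F) (s : Finset ι)
    (u : H) : b.truncate K s u = ∑ i ∈ s, inner ℂ (b i) u • K (b i) := by
  simp [HilbertBasis.truncate, sum_apply]

theorem HilbertBasis.isCompactOperator_truncate (b : HilbertBasis ι ℂ H) (K : H →L[ℂ] F)
    (s : Finset ι) : IsCompactOperator (b.truncate K s) := by
  refine Submodule.sum_mem (compactOperator (RingHom.id ℂ) H F) fun i _ => ?_
  have h : IsCompactOperator (innerSL ℂ (b i)) :=
    isCompactOperator_of_locallyCompactSpace_dom _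
  exact h.clm_comp ((ContinuousLinearMap.id ℂ ℂ).smulRight (K (b i)))

/-- Hilbert-Schmidt operators are compact. -/
theorem isCompactOperator_of_summable_norm_sq [CompleteSpace F] (b : HilbertBasis ι ℂ H)
    (K : H →L[ℂ] F) (hK : Summable fun i => ‖K (b i)‖ ^ 2) : IsCompactOperator K := by
  classical
  refine isCompactOperator_of_tendsto (F := fun s => b.truncate K s) (l := atTop) ?_
    (Eventually.of_forall fun s => b.isCompactOperator_truncate K s)
  rw [Metric.tendsto_atTop]
  intro ε hε
  obtain ⟨s, hs⟩ := summable_iff_vanishing_norm.1 hK ((ε / 2) ^ 2) (by positivity)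
  refine ⟨s, fun t hst => ?_⟩
  rw [dist_comm, dist_eq_norm]
  refine lt_of_le_of_lt (ContinuousLinearMap.opNorm_le_bound _ (by positivity : 0 ≤ ε / 2)
    fun u => ?_) (half_lt_self hε)
  have hsum : HasSum (fun i => inner ℂ (b i) u • K (b i)) (K u) := by
    have := (b.hasSum_repr u).mapL K
    simpa only [map_smul, b.repr_apply_apply] using this
  have hlim : Tendsto (fun r : Finset ι => ‖∑ i ∈ r, inner ℂ (b i) u • K (b i)
      - b.truncate K t u‖) atTop (𝓝 ‖K u - b.truncate K t u‖) :=
    (Tendsto.sub_const hsum _).norm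
  refine le_of_tendsto hlim ?_
  -- Outside `t` the expansion of `K u` is a tail: Cauchy-Schwarz bounds it by Bessel's inequality
  -- for `u` times the small tail of `∑ ‖K (b i)‖²`.
  filter_upwards [eventually_ge_atTop t] with r hr
  rw [b.truncate_apply, ← Finset.sum_sdiff hr, add_sub_cancel_right]
  have hd : Disjoint (r \ t) s := Finset.disjoint_of_subset_right hst Finset.sdiff_disjoint
  have h1 := hs _ hd
  rw [Real.norm_of_nonneg (Finset.sum_nonneg fun i _ => sq_nonneg _)] at h1
  refine (norm_sum_le _ _).trans (abs_le_of_sq_le_sq' ?_ (by positivity)).2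
  calc (∑ i ∈ r \ t, ‖inner ℂ (b i) u • K (b i)‖) ^ 2
      = (∑ i ∈ r \ t, ‖inner ℂ (b i) u‖ * ‖K (b i)‖) ^ 2 := by simp only [norm_smul]
    _ ≤ (∑ i ∈ r \ t, ‖inner ℂ (b i) u‖ ^ 2) * ∑ i ∈ r \ t, ‖K (b i)‖ ^ 2 :=
        Finset.sum_mul_sq_le_sq_mul_sq _ _ _
    _ ≤ ‖u‖ ^ 2 * (ε / 2) ^ 2 := by
        gcongr
        exact b.orthonormal.sum_inner_products_le _
    _ = (ε / 2 * ‖u‖) ^ 2 := by ring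

end HilbertSchmidt

/-! ### Integral operators with bounded kernel on a finite measure space. -/

section IntegralOperator

variable {α : Type*} [MeasurableSpace α]

theorem MeasureTheory.L2.norm_sq_eq_integral {μ : Measure α} (f : Lp ℂ 2 μ) :
    ‖f‖ ^ 2 = ∫ x, ‖f x‖ ^ 2 ∂μ := by
  have h : ((‖f‖ ^ 2 : ℝ) : ℂ) = ((∫ x, ‖f x‖ ^ 2 ∂μ : ℝ) : ℂ) := by
    have := inner_self_eq_norm_sq_to_K (𝕜 := ℂ) f
    rw [L2.inner_def] at this
    push_cast
    rw [← integral_complex_ofReal]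
    refine this.symm.trans (integral_congr_ae (Eventually.of_forall fun x => ?_))
    simp only [inner_self_eq_norm_sq_to_K]
    simp
  exact_mod_cast h

/-- `k` is a measurable kernel bounded by `M`. -/
structure IsBoundedKernel (k : α → α → ℂ) (M : ℝ) : Prop where
  measurable : Measurable (Function.uncurry k)
  nonneg : 0 ≤ M
  bound : ∀ x y, ‖k x y‖ ≤ M

namespace IsBoundedKernel

variable {k : α → α → ℂ} {M : ℝ}

theorem adjoint (h : IsBoundedKernel k M) :
    IsBoundedKernel (fun x y => star (k y x)) M where
  measurable := continuous_star.measurable.comp (h.measurable.comp measurable_swap)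
  nonneg := h.nonneg
  bound x y := by simpa using h.bound y x

theorem memLp_row (h : IsBoundedKernel k M) (μ : Measure α) [IsFiniteMeasure μ] (x : α) :
    MemLp (fun y => star (k x y)) 2 μ :=
  MemLp.of_bound (continuous_star.measurable.comp
    (h.measurable.comp measurable_prodMk_left)).aestronglyMeasurable M
    (Eventually.of_forall fun y => by simpa using h.bound x y)

/-- The function `y ↦ conj (k x y)` as an element of `L²`. -/
def row (h : IsBoundedKernel k M) (μ : Measure α) [IsFiniteMeasure μ] (x : α) : Lp ℂ 2 μ :=
  (h.memLp_row μ x).toLp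

variable {μ : Measure α} [IsFiniteMeasure μ]

/-- The conjugate in `row` cancels that of the inner product. Values of the integral operator thus
become inner products, to which Bessel's inequality applies. -/
theorem inner_row (h : IsBoundedKernel k M) (x : α) (u : Lp ℂ 2 μ) :
    inner ℂ (h.row μ x) u = ∫ y, k x y * u y ∂μ := by
  rw [L2.inner_def]
  refine integral_congr_ae ?_
  filter_upwards [(h.memLp_row μ x).coeFn_toLp] with y hy
  simp only [row, hy, RCLike.inner_apply]
  simp [mul_comm]

theorem norm_row_le (h : IsBoundedKernel k M) (x : α) :
    ‖h.row μ x‖ ≤ measureUnivNNReal μ ^ (2 : ENNReal).toReal⁻¹ * M := by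
  refine Lp.norm_le_of_ae_bound h.nonneg ?_
  filter_upwards [(h.memLp_row μ x).coeFn_toLp] with y hy
  rw [row, hy]
  simpa using h.bound x y

theorem norm_inner_row_le (h : IsBoundedKernel k M) (x : α) (u : Lp ℂ 2 μ) :
    ‖inner ℂ (h.row μ x) u‖ ≤ measureUnivNNReal μ ^ (2 : ENNReal).toReal⁻¹ * M * ‖u‖ :=
  (norm_inner_le_norm _ _).trans (by gcongr; exact h.norm_row_le x)

theorem memLp_inner_row (h : IsBoundedKernel k M) (u : Lp ℂ 2 μ) :
    MemLp (fun x => inner ℂ (h.row μ x) u) 2 μ := by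
  refine MemLp.of_bound ?_ _ (Eventually.of_forall fun x => h.norm_inner_row_le x u)
  simp only [h.inner_row]
  refine (StronglyMeasurable.integral_prod_right (f := fun x y => k x y * u y) ?_).aestronglyMeasurable
  exact h.measurable.stronglyMeasurable.mul
    ((Lp.stronglyMeasurable u).comp_measurable measurable_snd)

/-- The integral operator on `L²` with kernel `k`. -/
def toCLM (h : IsBoundedKernel k M) (μ : Measure α) [IsFiniteMeasure μ] :
    Lp ℂ 2 μ →L[ℂ] Lp ℂ 2 μ :=
  LinearMap.mkContinuous
    { toFun := fun u => (h.memLp_inner_row u).toLp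
      map_add' := fun u v => by
        rw [← MemLp.toLp_add]
        exact MemLp.toLp_congr _ _ (Eventually.of_forall fun x => inner_add_right _ _ _)
      map_smul' := fun c u => by
        rw [RingHom.id_apply, ← MemLp.toLp_const_smul]
        exact MemLp.toLp_congr _ _ (Eventually.of_forall fun x => inner_smul_right _ _ _) }
    (measureUnivNNReal μ ^ (2 : ENNReal).toReal⁻¹ *
      (measureUnivNNReal μ ^ (2 : ENNReal).toReal⁻¹ * M)) fun u => by
    rw [mul_assoc]
    refine Lp.norm_le_of_ae_bound (by have := h.nonneg; positivity) ?_
    filter_upwards [(h.memLp_inner_row u).coeFn_toLp] with x hx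
    exact (congrArg norm hx).le.trans (h.norm_inner_row_le x u)

theorem toCLM_apply_ae_eq_inner (h : IsBoundedKernel k M) (u : Lp ℂ 2 μ) :
    h.toCLM μ u =ᵐ[μ] fun x => inner ℂ (h.row μ x) u :=
  (h.memLp_inner_row u).coeFn_toLp

theorem toCLM_apply_ae_eq (h : IsBoundedKernel k M) (u : Lp ℂ 2 μ) :
    h.toCLM μ u =ᵐ[μ] fun x => ∫ y, k x y * u y ∂μ := by
  simpa only [h.inner_row] using h.toCLM_apply_ae_eq_inner u

theorem adjoint_toCLM (h : IsBoundedKernel k M) :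
    ContinuousLinearMap.adjoint (h.toCLM μ) = h.adjoint.toCLM μ := by
  symm
  rw [ContinuousLinearMap.eq_adjoint_iff]
  intro v u
  have hu : Integrable (fun x => u x) μ := (Lp.memLp u).integrable one_le_two
  have hv : Integrable (fun x => star (v x)) μ :=
    (Lp.memLp v).star.integrable one_le_two
  rw [L2.inner_def, L2.inner_def]
  have e1 : ∫ y, inner ℂ (h.adjoint.toCLM μ v y) (u y) ∂μ
      = ∫ y, ∫ x, k x y * (star (v x) * u y) ∂μ ∂μ := by
    refine integral_congr_ae ?_
    filter_upwards [h.adjoint.toCLM_apply_ae_eq v] with y hy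
    rw [hy, RCLike.inner_apply, ← integral_conj, ← integral_const_mul]
    refine integral_congr_ae (Eventually.of_forall fun x => ?_)
    simp
    ring
  have e2 : ∫ x, inner ℂ (v x) (h.toCLM μ u x) ∂μ
      = ∫ x, ∫ y, k x y * (star (v x) * u y) ∂μ ∂μ := by
    refine integral_congr_ae ?_
    filter_upwards [h.toCLM_apply_ae_eq u] with x hx
    rw [hx, RCLike.inner_apply, mul_comm, ← integral_const_mul]
    refine integral_congr_ae (Eventually.of_forall fun y => ?_)
    simp
    ring
  rw [e1, e2]
  refine (integral_integral_swap ?_).symm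
  -- Fubini applies: `L² ⊆ L¹` on a finite measure space, and the kernel is bounded.
  exact (hv.mul_prod hu).bdd_mul (c := M) h.measurable.aestronglyMeasurable
    (Eventually.of_forall fun p => h.bound p.1 p.2)

/-- At almost every `x`, Bessel's inequality bounds `∑ |(K b_i)(x)|²` by the squared norm of the row
at `x`, hence by `C²`. Integrating over the finite measure gives the Hilbert-Schmidt condition. -/
theorem isCompactOperator_toCLM (h : IsBoundedKernel k M) : IsCompactOperator (h.toCLM μ) := by
  obtain ⟨w, b, -⟩ := exists_hilbertBasis ℂ (Lp ℂ 2 μ)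
  set C : ℝ := measureUnivNNReal μ ^ (2 : ENNReal).toReal⁻¹ * M with hC
  refine isCompactOperator_of_summable_norm_sq b _
    (summable_of_sum_le (c := ∫ _, C ^ 2 ∂μ) (fun i => sq_nonneg _) fun s => ?_)
  have hint : ∀ f : Lp ℂ 2 μ, Integrable (fun x => ‖f x‖ ^ 2) μ := fun f =>
    (Lp.memLp f).integrable_norm_pow two_ne_zero
  simp only [L2.norm_sq_eq_integral]
  rw [← integral_finsetSum _ fun i _ => hint _]
  refine integral_mono_ae (integrable_finsetSum _ fun i _ => hint _) (integrable_const _) ?_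
  have hall : ∀ᵐ x ∂μ, ∀ i ∈ s, h.toCLM μ (b i) x = inner ℂ (h.row μ x) (b i) :=
    (Finset.eventually_all s).2 fun i _ => h.toCLM_apply_ae_eq_inner (b i)
  filter_upwards [hall] with x hx
  calc ∑ i ∈ s, ‖h.toCLM μ (b i) x‖ ^ 2 = ∑ i ∈ s, ‖inner ℂ (b i) (h.row μ x)‖ ^ 2 :=
        Finset.sum_congr rfl fun i hi => by rw [hx i hi, norm_inner_symm]
    _ ≤ ‖h.row μ x‖ ^ 2 := b.orthonormal.sum_inner_products_le _
    _ ≤ C ^ 2 := by gcongr; exact h.norm_row_le x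

end IsBoundedKernel

end IntegralOperator

/-! ### Absolute continuity of complex-valued integrals. -/

theorem AbsolutelyContinuousOnInterval.congr {X : Type*} [PseudoMetricSpace X] {f g : ℝ → X}
    {a b : ℝ} (hf : AbsolutelyContinuousOnInterval f a b) (hfg : EqOn f g (uIcc a b)) :
    AbsolutelyContinuousOnInterval g a b := by
  rw [absolutelyContinuousOnInterval_iff] at hf ⊢
  intro ε hε
  obtain ⟨δ, hδ, h⟩ := hf ε hε
  refine ⟨δ, hδ, fun E hE hlt => ?_⟩
  convert! h E hE hlt using 1
  refine Finset.sum_congr rfl fun i hi => ?_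
  have := hE.1 i hi
  rw [hfg this.1, hfg this.2]

theorem AbsolutelyContinuousOnInterval.const {X : Type*} [PseudoMetricSpace X] (x : X) (a b : ℝ) :
    AbsolutelyContinuousOnInterval (fun _ => x) a b :=
  (LipschitzWith.const x).lipschitzOnWith.absolutelyContinuousOnInterval

theorem IntervalIntegrable.absolutelyContinuousOnInterval_complex {u : ℝ → ℂ} {a b c : ℝ}
    (hu : IntervalIntegrable u volume a b) (hc : c ∈ uIcc a b) :
    AbsolutelyContinuousOnInterval (fun x => ∫ t in c..x, u t) a b := by
  have hre : IntervalIntegrable (fun t => (u t).re) volume a b := ⟨hu.1.re, hu.2.re⟩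
  have him : IntervalIntegrable (fun t => (u t).im) volume a b := ⟨hu.1.im, hu.2.im⟩
  have h1 := (hre.absolutelyContinuousOnInterval_intervalIntegral hc).fun_smul
    (AbsolutelyContinuousOnInterval.const (1 : ℂ) a b)
  have h2 := (him.absolutelyContinuousOnInterval_intervalIntegral hc).fun_smul
    (AbsolutelyContinuousOnInterval.const Complex.I a b)
  refine (h1.add h2).congr fun x hx => ?_
  have hsub : IntervalIntegrable u volume c x := hu.mono_set (uIcc_subset_uIcc hc hx)
  have e : ∀ t, u t = ((u t).re : ℂ) + ((u t).im : ℂ) * Complex.I := fun t =>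
    (Complex.re_add_im _).symm
  have hre' : IntervalIntegrable (fun t => ((u t).re : ℂ)) volume c x :=
    ⟨hsub.1.re.ofReal, hsub.2.re.ofReal⟩
  have him' : IntervalIntegrable (fun t => ((u t).im : ℂ)) volume c x :=
    ⟨hsub.1.im.ofReal, hsub.2.im.ofReal⟩
  calc _ = (∫ t in c..x, ((u t).re : ℂ)) + (∫ t in c..x, ((u t).im : ℂ)) * Complex.I := by
        simp [intervalIntegral.integral_ofReal]
    _ = ∫ t in c..x, (((u t).re : ℂ) + ((u t).im : ℂ) * Complex.I) := by
        rw [intervalIntegral.integral_add hre' (him'.mul_const _),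
          intervalIntegral.integral_mul_const]
    _ = ∫ t in c..x, u t := by simp only [← e]

/-! ### The scalar equation `g' - p g = u` on `(0, L)`. -/

namespace KerrDeSitter

variable {L : ℝ}

/-- A property which holds a.e. on the compact subintervals of `(0, L)` holds a.e. on `(0, L)`. -/
theorem ae_measureI_of_forall_compact {Q : ℝ → Prop}
    (h : ∀ c d : ℝ, 0 < c → c ≤ d → d < L → ∀ᵐ x, x ∈ Ioo c d → Q x) : ∀ᵐ x ∂measureI L, Q x := by
  have key : ∀ n : ℕ, ∀ᵐ x, x ∈ Ioo (1 / ((n : ℝ) + 1)) (L - 1 / ((n : ℝ) + 1)) → Q x := by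
    intro n
    have hn : (0 : ℝ) < 1 / ((n : ℝ) + 1) := by positivity
    by_cases hle : 1 / ((n : ℝ) + 1) ≤ L - 1 / ((n : ℝ) + 1)
    · exact h _ _ hn hle (by linarith)
    · filter_upwards with x hx
      exact absurd (hx.1.trans hx.2).le hle
  rw [ae_restrict_iff' measurableSet_Ioo]
  filter_upwards [ae_all_iff.2 key] with x hx hxI
  obtain ⟨n, hn⟩ := exists_nat_one_div_lt (lt_min hxI.1 (sub_pos.2 hxI.2))
  rw [lt_min_iff] at hn
  exact hx n ⟨hn.1, by linarith [hn.2]⟩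

theorem Icc_subset_Ioo_of_lt {c d : ℝ} (hc : 0 < c) (hd : d < L) : Icc c d ⊆ Ioo 0 L :=
  fun _ hx => ⟨hc.trans_le hx.1, hx.2.trans_lt hd⟩

theorem IsLocAC.mul {f g : ℝ → ℂ} (hf : IsLocAC L f) (hg : IsLocAC L g) :
    IsLocAC L (fun x => f x * g x) := fun c d h0 h1 h2 =>
  (hf c d h0 h1 h2).fun_smul (hg c d h0 h1 h2)

theorem isLocAC_of_hasDerivAt {f f' : ℝ → ℂ} (hf : ∀ x ∈ Ioo 0 L, HasDerivAt f (f' x) x)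
    (hf' : ContinuousOn f' (Ioo 0 L)) : IsLocAC L f := by
  intro c d h0 h1 h2
  have hsub := Icc_subset_Ioo_of_lt h0 h2
  obtain ⟨C, hC⟩ := isCompact_Icc.exists_bound_of_continuousOn (hf'.mono hsub)
  have hlip : LipschitzOnWith C.toNNReal f (uIcc c d) := by
    rw [uIcc_of_le h1]
    refine (convex_Icc c d).lipschitzOnWith_of_nnnorm_hasDerivWithin_le
      (fun x hx => (hf x (hsub hx)).hasDerivWithinAt) fun x hx => ?_
    rw [← NNReal.coe_le_coe, coe_nnnorm]
    exact (hC x hx).trans (Real.le_coe_toNNReal C)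
  exact hlip.absolutelyContinuousOnInterval

/-- `Φ` is a primitive of the locally integrable function `u` on `(0, L)`. -/
structure IsPrimitive (L : ℝ) (Φ u : ℝ → ℂ) : Prop where
  integrable : ∀ c d : ℝ, 0 < c → c ≤ d → d < L → IntervalIntegrable u volume c d
  sub_eq : ∀ c d : ℝ, 0 < c → c ≤ d → d < L → Φ d - Φ c = ∫ t in c..d, u t

theorem IsPrimitive.eqOn {Φ u : ℝ → ℂ} (h : IsPrimitive L Φ u) {c d : ℝ} (h0 : 0 < c)
    (h2 : d < L) : EqOn (fun x => Φ c + ∫ t in c..x, u t) Φ (Icc c d) := by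
  intro x hx
  change Φ c + _ = Φ x
  rw [← h.sub_eq c x h0 hx.1 (hx.2.trans_lt h2)]
  ring

theorem IsPrimitive.isLocAC {Φ u : ℝ → ℂ} (h : IsPrimitive L Φ u) : IsLocAC L Φ := by
  intro c d h0 h1 h2
  refine AbsolutelyContinuousOnInterval.congr ((AbsolutelyContinuousOnInterval.const (Φ c) c d).add
    ((h.integrable c d h0 h1 h2).absolutelyContinuousOnInterval_complex left_mem_uIcc)) ?_
  rw [uIcc_of_le h1]
  exact h.eqOn h0 h2

theorem IsPrimitive.ae_hasDerivAt {Φ u : ℝ → ℂ} (h : IsPrimitive L Φ u) :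
    ∀ᵐ x ∂measureI L, HasDerivAt Φ (u x) x := by
  refine ae_measureI_of_forall_compact fun c d h0 h1 h2 => ?_
  filter_upwards [(h.integrable c d h0 h1 h2).ae_hasDerivAt_integral] with x hx hxI
  have hxI' : x ∈ uIcc c d := by rw [uIcc_of_le h1]; exact Ioo_subset_Icc_self hxI
  refine ((hx hxI' c left_mem_uIcc).const_add (Φ c)).congr_of_eventuallyEq ?_
  exact ((h.eqOn h0 h2).symm.mono Ioo_subset_Icc_self).eventuallyEq_of_mem (isOpen_Ioo.mem_nhds hxI)

/-- `P' = p` on `(0, L)`, with `p` continuous. -/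
structure IsC1Primitive (L : ℝ) (P p : ℝ → ℝ) : Prop where
  hasDerivAt : ∀ x ∈ Ioo 0 L, HasDerivAt P (p x) x
  continuousOn : ContinuousOn p (Ioo 0 L)

namespace IsC1Primitive

variable {P p : ℝ → ℝ}

theorem neg (h : IsC1Primitive L P p) : IsC1Primitive L (-P) (-p) :=
  ⟨fun x hx => (h.hasDerivAt x hx).neg, h.continuousOn.neg⟩

theorem continuousOn_primitive (h : IsC1Primitive L P p) : ContinuousOn P (Ioo 0 L) :=
  fun x hx => (h.hasDerivAt x hx).continuousAt.continuousWithinAt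

theorem hasDerivAt_exp (h : IsC1Primitive L P p) {x : ℝ} (hx : x ∈ Ioo 0 L) :
    HasDerivAt (fun x => (Real.exp (P x) : ℂ)) ((p x : ℂ) * (Real.exp (P x) : ℂ)) x := by
  have := (h.hasDerivAt x hx).exp.ofReal_comp
  simpa [mul_comm] using this

theorem isLocAC_exp (h : IsC1Primitive L P p) : IsLocAC L (fun x => (Real.exp (P x) : ℂ)) := by
  refine isLocAC_of_hasDerivAt (fun x hx => h.hasDerivAt_exp hx) ?_
  exact (Complex.continuous_ofReal.comp_continuousOn h.continuousOn).mul
    (Complex.continuous_ofReal.comp_continuousOn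
      (Real.continuous_exp.comp_continuousOn h.continuousOn_primitive))

/-- Solutions of `G' = p G` are multiples of `exp P`. -/
theorem exists_eq_mul_exp (h : IsC1Primitive L P p) (hL : 0 < L) {G : ℝ → ℂ} (hG : IsLocAC L G)
    (hd : ∀ᵐ x ∂measureI L, HasDerivAt G ((p x : ℂ) * G x) x) :
    ∃ C : ℂ, ∀ x ∈ Ioo 0 L, G x = C * (Real.exp (P x) : ℂ) := by
  -- Integrating factor: `F` is locally absolutely continuous with derivative zero a.e., hence
  -- constant.
  set F : ℝ → ℂ := fun x => (Real.exp ((-P) x) : ℂ) * G x with hF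
  have hFac : IsLocAC L F := h.neg.isLocAC_exp.mul hG
  have hFd : ∀ᵐ x, x ∈ Ioo 0 L → HasDerivAt F 0 x := by
    rw [ae_restrict_iff' measurableSet_Ioo] at hd
    filter_upwards [hd] with x hx hxI
    refine ((h.neg.hasDerivAt_exp hxI).mul (hx hxI)).congr_deriv ?_
    simp only [Pi.neg_apply]
    push_cast
    ring
  have hc : ∀ c d : ℝ, 0 < c → c ≤ d → d < L → F c = F d := by
    intro c d h0 h1 h2
    obtain ⟨C, hC⟩ := (hFac c d h0 h1 h2).const_of_ae_hasDerivAt_zero (by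
      filter_upwards [hFd] with x hx hxI
      rw [uIcc_of_le h1] at hxI
      exact hx (Icc_subset_Ioo_of_lt h0 h2 hxI))
    rw [hC c left_mem_uIcc, hC d right_mem_uIcc]
  refine ⟨F (L / 2), fun x hx => ?_⟩
  have e : F (L / 2) = F x := by
    rcases le_total x (L / 2) with hle | hle
    · exact (hc _ _ hx.1 hle (by linarith)).symm
    · exact hc _ _ (by linarith) hle hx.2
  rw [e, hF]
  simp only [Pi.neg_apply, Real.exp_neg]
  push_cast
  field_simp [Complex.exp_ne_zero]

end IsC1Primitive

/-- `g` has a locally absolutely continuous representative and `g' - p g = u`. -/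
def IsFirstOrderPair (L : ℝ) (p : ℝ → ℝ) (g u : Lp ℂ 2 (measureI L)) : Prop :=
  ∃ G : ℝ → ℂ, IsLocAC L G ∧ g =ᵐ[measureI L] G ∧
    u =ᵐ[measureI L] fun x => deriv G x - (p x : ℂ) * G x

/-- The difference of two solutions is `C exp P`, which lies in `L²` only for `C = 0`. -/
theorem IsFirstOrderPair.unique {P p : ℝ → ℝ} (hP : IsC1Primitive L P p) (hL : 0 < L)
    (hnot : ¬ MemLp (fun x => Real.exp (P x)) 2 (measureI L)) {g g' u : Lp ℂ 2 (measureI L)}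
    (h : IsFirstOrderPair L p g u) (h' : IsFirstOrderPair L p g' u) : g = g' := by
  obtain ⟨G, hG, hgG, hu⟩ := h
  obtain ⟨G', hG', hgG', hu'⟩ := h'
  have hD : IsLocAC L (G + (-1 : ℂ) • G') := hG.add (hG'.const_smul _)
  obtain ⟨C, hC⟩ := hP.exists_eq_mul_exp hL hD (by
    filter_upwards [hu, hu', hG.ae_differentiableAt, hG'.ae_differentiableAt] with x e e' d d'
    refine (d.hasDerivAt.add (d'.hasDerivAt.const_smul (-1 : ℂ))).congr_deriv ?_
    have := e.symm.trans e'
    simp only [Pi.add_apply, Pi.smul_apply, smul_eq_mul]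
    linear_combination this)
  have hI : ∀ᵐ x ∂measureI L, x ∈ Ioo 0 L := ae_restrict_mem measurableSet_Ioo
  have hdiff : ∀ᵐ x ∂measureI L, (g - g') x = C * (Real.exp (P x) : ℂ) := by
    filter_upwards [Lp.coeFn_sub g g', hgG, hgG', hI] with x e1 e2 e3 hx
    rw [e1, Pi.sub_apply, e2, e3, ← hC x hx]
    simp [sub_eq_add_neg]
  have hC0 : C = 0 := by
    by_contra hC0
    refine hnot (((Lp.memLp (g - g')).const_mul C⁻¹).norm.ae_eq ?_)
    filter_upwards [hdiff] with x hx
    rw [hx, inv_mul_cancel_left₀ hC0, Complex.norm_real, Real.norm_of_nonneg (Real.exp_pos _).le]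
  refine Lp.ext ?_
  filter_upwards [hdiff, Lp.coeFn_sub g g'] with x e1 e2
  rw [e1, hC0, zero_mul, Pi.sub_apply] at e2
  exact (sub_eq_zero.1 e2.symm)

/-- Variation of constants. -/
theorem isFirstOrderPair_of_isPrimitive {P p : ℝ → ℝ} (hP : IsC1Primitive L P p)
    {g u : Lp ℂ 2 (measureI L)} {Φ : ℝ → ℂ}
    (hΦ : IsPrimitive L Φ (fun t => (Real.exp (-P t) : ℂ) * u t))
    (hg : g =ᵐ[measureI L] fun x => (Real.exp (P x) : ℂ) * Φ x) : IsFirstOrderPair L p g u := by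
  refine ⟨_, hP.isLocAC_exp.mul hΦ.isLocAC, hg, ?_⟩
  have hI : ∀ᵐ x ∂measureI L, x ∈ Ioo 0 L := ae_restrict_mem measurableSet_Ioo
  filter_upwards [hI, hΦ.ae_hasDerivAt] with x hx hd
  rw [((hP.hasDerivAt_exp hx).fun_mul hd).deriv]
  have : (Real.exp (P x) : ℂ) * (Real.exp (-P x) : ℂ) = 1 := by
    rw [← Complex.ofReal_mul, ← Real.exp_add]; simp
  linear_combination -(u x) * this

theorem isFirstOrderPair_iff {P p : ℝ → ℝ} (hP : IsC1Primitive L P p) (hL : 0 < L)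
    (hnot : ¬ MemLp (fun x => Real.exp (P x)) 2 (measureI L))
    {K : Lp ℂ 2 (measureI L) → Lp ℂ 2 (measureI L)}
    (hK : ∀ u, ∃ Φ, IsPrimitive L Φ (fun t => (Real.exp (-P t) : ℂ) * u t) ∧
      K u =ᵐ[measureI L] fun x => (Real.exp (P x) : ℂ) * Φ x) (g u : Lp ℂ 2 (measureI L)) :
    IsFirstOrderPair L p g u ↔ g = K u := by
  obtain ⟨Φ, hΦ, hKu⟩ := hK u
  have h := isFirstOrderPair_of_isPrimitive hP hΦ hKu
  exact ⟨fun hg => hg.unique hP hL hnot h, fun hg => hg ▸ h⟩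

end KerrDeSitter

/-! ### Endpoint behaviour of homogeneous solutions, and the compact inverse. -/

namespace KerrDeSitter

variable {L : ℝ}

theorem not_memLp_of_inv_le {f : ℝ → ℝ} {s : Set ℝ} (hs : s ⊆ Ioo 0 L) (hsm : MeasurableSet s)
    {r : ℝ → ℝ} (hr : ¬ IntegrableOn r s) (hrm : AEStronglyMeasurable r (volume.restrict s))
    {D : ℝ} (h : ∀ x ∈ s, ‖r x‖ ≤ D * f x ^ 2) : ¬ MemLp f 2 (measureI L) := by
  intro hf
  have h1 : IntegrableOn (fun x => D * f x ^ 2) s :=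
    (IntegrableOn.mono_set (s := s) (t := Ioo 0 L) hf.integrable_sq hs).const_mul D
  refine hr (h1.mono' hrm ?_)
  filter_upwards [ae_restrict_mem hsm] with x hx using h x hx

theorem not_integrableOn_inv {c : ℝ} (hc : 0 < c) :
    ¬ IntegrableOn (fun x : ℝ => x⁻¹) (Ioo 0 c) := by
  rw [← intervalIntegrable_iff_integrableOn_Ioo_of_le hc.le, intervalIntegrable_inv_iff]
  simp [hc.ne, hc.le]

theorem not_integrableOn_inv_sub {c : ℝ} (hc : c < L) :
    ¬ IntegrableOn (fun x : ℝ => (x - L)⁻¹) (Ioo c L) := by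
  rw [← intervalIntegrable_iff_integrableOn_Ioo_of_le hc.le, intervalIntegrable_sub_inv_iff]
  simp [hc.ne, hc.le]

namespace IsC1Primitive

variable {P p : ℝ → ℝ}

theorem monotoneOn_add (h : IsC1Primitive L P p) {q q' : ℝ → ℝ}
    (hq : ∀ x ∈ Ioo 0 L, HasDerivAt q (q' x) x) (hle : ∀ x ∈ Ioo 0 L, 0 ≤ p x + q' x) :
    MonotoneOn (fun x => P x + q x) (Ioo 0 L) := by
  have hd : ∀ x ∈ Ioo 0 L, HasDerivAt (fun x => P x + q x) (p x + q' x) x := fun x hx =>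
    (h.hasDerivAt x hx).add (hq x hx)
  refine monotoneOn_of_deriv_nonneg (convex_Ioo 0 L)
    (fun x hx => (hd x hx).continuousAt.continuousWithinAt)
    (fun x hx => (hd x (interior_subset hx)).differentiableAt.differentiableWithinAt) fun x hx => ?_
  rw [(hd x (interior_subset hx)).deriv]
  exact hle x (interior_subset hx)

/-- Since `P + C x` is increasing, `P x - P y ≤ C (y - x)`. This bounds the kernel `exp (P x - P y)`
on `x < y`. -/
theorem sub_le (h : IsC1Primitive L P p) {C : ℝ} (hp : ∀ x ∈ Ioo 0 L, -C ≤ p x) (hC : 0 ≤ C)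
    {x y : ℝ} (hx : x ∈ Ioo 0 L) (hy : y ∈ Ioo 0 L) (hxy : x < y) : P x - P y ≤ C * L := by
  have := h.monotoneOn_add (q := fun x => C * x) (q' := fun _ => C)
    (fun x _ => by simpa using (hasDerivAt_id x).const_mul C)
    (fun x hx => by linarith [hp x hx]) hx hy hxy.le
  simp only at this
  nlinarith [hx.1, hy.2, mul_nonneg hC hx.1.le, mul_nonneg hC (sub_nonneg.2 hy.2.le)]

/-- As `P + C x - (1/2) log x` is increasing, `P ≤ (1/2) log x + D` on `(0, L/2)`. Hence `exp(-P)² ≥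
exp(-2D) / x`, which is not integrable at `0`. -/
theorem not_memLp_exp_neg (h : IsC1Primitive L P p) (hL : 0 < L) {C : ℝ} (hC : 0 ≤ C)
    (hp : ∀ x ∈ Ioo 0 L, 1 / (2 * x) - C ≤ p x) :
    ¬ MemLp (fun x => Real.exp (-P x)) 2 (measureI L) := by
  have hm := h.monotoneOn_add (q := fun x => C * x - 1 / 2 * Real.log x)
    (q' := fun x => C - 1 / 2 * x⁻¹)
    (fun x hx => by
      refine (((hasDerivAt_id x).const_mul C).sub
        ((Real.hasDerivAt_log hx.1.ne').const_mul (1 / 2 : ℝ))).congr_deriv ?_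
      ring)
    (fun x hx => by have := hp x hx; rw [one_div, mul_inv] at this; linarith)
  set c := L / 2 with hc
  have hcI : c ∈ Ioo 0 L := ⟨by linarith, by linarith⟩
  set D := P c + (C * c - 1 / 2 * Real.log c) with hD
  refine not_memLp_of_inv_le (s := Ioo 0 c) (r := fun x => x⁻¹) (D := Real.exp (2 * D))
    (Ioo_subset_Ioo_right hcI.2.le) measurableSet_Ioo (not_integrableOn_inv hcI.1)
    measurable_inv.aestronglyMeasurable fun x hx => ?_
  have h1 := hm ⟨hx.1, hx.2.trans hcI.2⟩ hcI hx.2.le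
  simp only at h1
  rw [Real.norm_of_nonneg (inv_nonneg.2 hx.1.le), ← Real.exp_log (inv_pos.2 hx.1), Real.log_inv,
    ← Real.exp_nat_mul, ← Real.exp_add]
  refine Real.exp_le_exp.2 ?_
  push_cast
  nlinarith [mul_nonneg hC hx.1.le]

/-- The counterpart at `L`: since `P + C x + (1/2) log (L - x)` is increasing, `exp(P)²` dominates a
multiple of `1/(L - x)`. -/
theorem not_memLp_exp (h : IsC1Primitive L P p) (hL : 0 < L) {C : ℝ} (hC : 0 ≤ C)
    (hp : ∀ x ∈ Ioo 0 L, 1 / (2 * (L - x)) - C ≤ p x) :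
    ¬ MemLp (fun x => Real.exp (P x)) 2 (measureI L) := by
  have hm := h.monotoneOn_add (q := fun x => C * x + 1 / 2 * Real.log (L - x))
    (q' := fun x => C - 1 / 2 * (L - x)⁻¹)
    (fun x hx => by
      have h1 := (((hasDerivAt_id x).const_sub L).log (sub_pos.2 hx.2).ne').const_mul (1 / 2 : ℝ)
      refine (((hasDerivAt_id x).const_mul C).add h1).congr_deriv ?_
      simp only [id]
      ring)
    (fun x hx => by have := hp x hx; rw [one_div, mul_inv] at this; linarith)
  set c := L / 2 with hc
  have hcI : c ∈ Ioo 0 L := ⟨by linarith, by linarith⟩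
  set D := P c + (C * c + 1 / 2 * Real.log (L - c)) - C * L with hD
  refine not_memLp_of_inv_le (s := Ioo c L) (r := fun x => (x - L)⁻¹) (D := Real.exp (-2 * D))
    (Ioo_subset_Ioo_left hcI.1.le) measurableSet_Ioo (not_integrableOn_inv_sub hcI.2)
    (measurable_inv.comp (measurable_id.sub_const L)).aestronglyMeasurable fun x hx => ?_
  have h1 := hm hcI ⟨hcI.1.trans hx.1, hx.2⟩ hx.1.le
  simp only at h1
  have hLx : 0 < L - x := sub_pos.2 hx.2
  rw [norm_inv, norm_sub_rev, Real.norm_of_nonneg hLx.le, ← Real.exp_log (inv_pos.2 hLx),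
    Real.log_inv, ← Real.exp_nat_mul, ← Real.exp_add]
  refine Real.exp_le_exp.2 ?_
  push_cast
  nlinarith [mul_nonneg hC hLx.le]

end IsC1Primitive

/-- Every continuous function on `(0, L)` has a measurable primitive. -/
theorem exists_isC1Primitive {p : ℝ → ℝ} (hL : 0 < L) (hp : ContinuousOn p (Ioo 0 L)) :
    ∃ P : ℝ → ℝ, Measurable P ∧ IsC1Primitive L P p := by
  classical
  set P₀ : ℝ → ℝ := fun x => ∫ t in (L / 2)..x, p t with hP₀
  have hd : ∀ x ∈ Ioo 0 L, HasDerivAt P₀ (p x) x := by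
    intro x hx
    have hsub : uIcc (L / 2) x ⊆ Ioo 0 L :=
      (convex_Ioo 0 L).ordConnected.uIcc_subset ⟨by linarith, by linarith⟩ hx
    exact intervalIntegral.integral_hasDerivAt_right (hp.mono hsub).intervalIntegrable
      (hp.stronglyMeasurableAtFilter isOpen_Ioo x hx) (hp.continuousAt (isOpen_Ioo.mem_nhds hx))
  -- The value zero outside the interval makes the primitive measurable on all of `ℝ`, as
  -- measurability of the kernel requires.
  refine ⟨(Ioo 0 L).piecewise P₀ 0, ?_, fun x hx => ?_, hp⟩
  · exact ContinuousOn.measurable_piecewise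
      (fun x hx => (hd x hx).continuousAt.continuousWithinAt) continuousOn_const measurableSet_Ioo
  · refine (hd x hx).congr_of_eventuallyEq ?_
    filter_upwards [isOpen_Ioo.mem_nhds hx] with y hy using piecewise_eq_of_mem _ _ _ hy

/-- The kernel of the inverse of `g ↦ g' - P' g`. -/
def firstOrderKernel (L : ℝ) (P : ℝ → ℝ) (x y : ℝ) : ℂ :=
  open Classical in if x < y ∧ x ∈ Ioo 0 L ∧ y ∈ Ioo 0 L then -(Real.exp (P x - P y) : ℂ) else 0

theorem isBoundedKernel_firstOrderKernel {P p : ℝ → ℝ} (hPm : Measurable P)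
    (hP : IsC1Primitive L P p) {C : ℝ} (hC : 0 ≤ C) (hp : ∀ x ∈ Ioo 0 L, -C ≤ p x) :
    IsBoundedKernel (firstOrderKernel L P) (Real.exp (C * L)) where
  measurable := by
    unfold firstOrderKernel Function.uncurry
    refine Measurable.ite ?_ ?_ measurable_const
    · exact (measurableSet_lt measurable_fst measurable_snd).inter
        ((measurable_fst measurableSet_Ioo).inter (measurable_snd measurableSet_Ioo))
    · exact (Complex.measurable_ofReal.comp (Real.measurable_exp.comp
        ((hPm.comp measurable_fst).sub (hPm.comp measurable_snd)))).neg
  nonneg := (Real.exp_pos _).le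
  bound x y := by
    unfold firstOrderKernel
    split_ifs with h
    · rw [norm_neg, Complex.norm_real, Real.norm_of_nonneg (Real.exp_pos _).le]
      exact Real.exp_le_exp.2 (hP.sub_le hp hC h.2.1 h.2.2 h.1)
    · simpa using (Real.exp_pos _).le

theorem integrableOn_exp_mul {P p : ℝ → ℝ} (hP : IsC1Primitive L P p) (u : Lp ℂ 2 (measureI L))
    {s : Set ℝ} (hs : s ⊆ Ioo 0 L) (hsm : MeasurableSet s) {D : ℝ} (hD : ∀ x ∈ s, P x ≤ D) :
    IntegrableOn (fun t => (Real.exp (P t) : ℂ) * u t) s := by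
  have hu : IntegrableOn (fun t => u t) s :=
    IntegrableOn.mono_set (t := Ioo 0 L) ((Lp.memLp u).integrable one_le_two) hs
  refine hu.bdd_mul (c := Real.exp D) ?_ ?_
  · exact (Complex.continuous_ofReal.comp_continuousOn (Real.continuous_exp.comp_continuousOn
      (hP.continuousOn_primitive.mono hs))).aestronglyMeasurable hsm
  · filter_upwards [ae_restrict_mem hsm] with x hx
    rw [Complex.norm_real, Real.norm_of_nonneg (Real.exp_pos _).le]
    exact Real.exp_le_exp.2 (hD x hx)

theorem isPrimitive_setIntegral_left {u : ℝ → ℂ}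
    (hu : ∀ d ∈ Ioo 0 L, IntegrableOn u (Ioo 0 d)) :
    IsPrimitive L (fun x => ∫ t in Ioo 0 x, u t) u := by
  have hi : ∀ d ∈ Ioo 0 L, IntervalIntegrable u volume 0 d := fun d hd =>
    (intervalIntegrable_iff_integrableOn_Ioo_of_le hd.1.le).2 (hu d hd)
  have hcd : ∀ c d : ℝ, 0 < c → c ≤ d → d < L → IntervalIntegrable u volume c d :=
    fun c d h0 h1 h2 => (hi c ⟨h0, h1.trans_lt h2⟩).symm.trans (hi d ⟨h0.trans_le h1, h2⟩)
  refine ⟨hcd, fun c d h0 h1 h2 => ?_⟩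
  simp only [← integral_Ioc_eq_integral_Ioo]
  rw [← intervalIntegral.integral_of_le h0.le, ← intervalIntegral.integral_of_le (h0.le.trans h1)]
  exact intervalIntegral.integral_interval_sub_left (hi d ⟨h0.trans_le h1, h2⟩)
    (hi c ⟨h0, h1.trans_lt h2⟩)

theorem isPrimitive_setIntegral_right {u : ℝ → ℂ}
    (hu : ∀ c ∈ Ioo 0 L, IntegrableOn u (Ioo c L)) :
    IsPrimitive L (fun x => -∫ t in Ioo x L, u t) u := by
  have hi : ∀ d ∈ Ioo 0 L, IntervalIntegrable u volume d L := fun d hd =>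
    (intervalIntegrable_iff_integrableOn_Ioo_of_le hd.2.le).2 (hu d hd)
  have hcd : ∀ c d : ℝ, 0 < c → c ≤ d → d < L → IntervalIntegrable u volume c d :=
    fun c d h0 h1 h2 => (hi c ⟨h0, h1.trans_lt h2⟩).trans (hi d ⟨h0.trans_le h1, h2⟩).symm
  refine ⟨hcd, fun c d h0 h1 h2 => ?_⟩
  simp only [← integral_Ioc_eq_integral_Ioo]
  rw [← intervalIntegral.integral_of_le h2.le, ← intervalIntegral.integral_of_le (h1.trans h2.le),
    ← intervalIntegral.integral_add_adjacent_intervals (hcd c d h0 h1 h2) (hi d ⟨h0.trans_le h1, h2⟩)]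
  ring

theorem integral_firstOrderKernel {P : ℝ → ℝ} {x : ℝ} (hx : x ∈ Ioo 0 L) (u : ℝ → ℂ) :
    ∫ y, firstOrderKernel L P x y * u y ∂measureI L
      = (Real.exp (P x) : ℂ) * -∫ t in Ioo x L, (Real.exp (-P t) : ℂ) * u t := by
  have e : ∀ y ∈ Ioo 0 L, firstOrderKernel L P x y * u y =
      (Ioi x).indicator (fun t => -(Real.exp (P x) : ℂ) * ((Real.exp (-P t) : ℂ) * u t)) y := by
    intro y hy
    by_cases hxy : x < y
    · rw [firstOrderKernel, if_pos ⟨hxy, hx, hy⟩, indicator_of_mem (mem_Ioi.2 hxy), sub_eq_add_neg,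
        Real.exp_add]
      push_cast
      ring
    · rw [firstOrderKernel, if_neg (fun h => hxy h.1), indicator_of_notMem (by simpa using hxy),
        zero_mul]
  rw [setIntegral_congr_fun measurableSet_Ioo e, setIntegral_indicator measurableSet_Ioi,
    integral_const_mul, Ioo_inter_Ioi, max_eq_right hx.1.le]
  ring

theorem integral_adjoint_firstOrderKernel {P : ℝ → ℝ} {x : ℝ} (hx : x ∈ Ioo 0 L) (u : ℝ → ℂ) :
    ∫ y, star (firstOrderKernel L P y x) * u y ∂measureI L
      = -((Real.exp (-P x) : ℂ) * ∫ t in Ioo 0 x, (Real.exp (P t) : ℂ) * u t) := by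
  have e : ∀ y ∈ Ioo 0 L, star (firstOrderKernel L P y x) * u y =
      (Iio x).indicator (fun t => -(Real.exp (-P x) : ℂ) * ((Real.exp (P t) : ℂ) * u t)) y := by
    intro y hy
    by_cases hxy : y < x
    · rw [firstOrderKernel, if_pos ⟨hxy, hy, hx⟩, indicator_of_mem (mem_Iio.2 hxy), sub_eq_add_neg,
        Real.exp_add, star_neg, Complex.star_def, Complex.conj_ofReal]
      push_cast
      ring
    · rw [firstOrderKernel, if_neg (fun h => hxy h.1), indicator_of_notMem (by simpa using hxy),
        star_zero, zero_mul]
  rw [setIntegral_congr_fun measurableSet_Ioo e, setIntegral_indicator measurableSet_Iio,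
    integral_const_mul, Ioo_inter_Iio, min_eq_right hx.2.le]
  ring

/-- If `p ≥ 1 / (2 x) - C` and `p ≥ 1 / (2 (L - x)) - C`, then `g ↦ g' - p g` has a compact
inverse `K` in `L²(0, L)`, and `- K†` is the inverse of `f ↦ f' + p f`. -/
theorem exists_compact_inverse {p : ℝ → ℝ} (hL : 0 < L) (hp : ContinuousOn p (Ioo 0 L)) {C : ℝ}
    (hC : 0 ≤ C) (hp0 : ∀ x ∈ Ioo 0 L, 1 / (2 * x) - C ≤ p x)
    (hpL : ∀ x ∈ Ioo 0 L, 1 / (2 * (L - x)) - C ≤ p x) :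
    ∃ K : Lp ℂ 2 (measureI L) →L[ℂ] Lp ℂ 2 (measureI L), IsCompactOperator K ∧
      IsCompactOperator (ContinuousLinearMap.adjoint K) ∧
      (∀ g u, IsFirstOrderPair L p g u ↔ g = K u) ∧
      ∀ f v, IsFirstOrderPair L (-p) f v ↔ f = -ContinuousLinearMap.adjoint K v := by
  obtain ⟨P, hPm, hP⟩ := exists_isC1Primitive hL hp
  have hpC : ∀ x ∈ Ioo 0 L, -C ≤ p x := fun x hx => by
    have h1 : 0 < 1 / (2 * x) := one_div_pos.2 (mul_pos two_pos hx.1)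
    linarith [hp0 x hx]
  have hk := isBoundedKernel_firstOrderKernel hPm hP hC hpC
  have hI : ∀ᵐ x ∂measureI L, x ∈ Ioo 0 L := ae_restrict_mem measurableSet_Ioo
  refine ⟨hk.toCLM _, hk.isCompactOperator_toCLM, ?_, ?_, ?_⟩
  · rw [hk.adjoint_toCLM]
    exact hk.adjoint.isCompactOperator_toCLM
  -- The solution integrates from the right endpoint: `exp(-P)` is bounded on `(c, L)`, although it
  -- need not be near `0`.
  · refine isFirstOrderPair_iff hP hL (hP.not_memLp_exp hL hC hpL) fun u => ⟨_,
      isPrimitive_setIntegral_right fun c hc => ?_, ?_⟩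
    · refine integrableOn_exp_mul hP.neg u (Ioo_subset_Ioo_left hc.1.le) measurableSet_Ioo
        (D := C * L - P c) fun y hy => ?_
      have := hP.sub_le hpC hC hc ⟨hc.1.trans hy.1, hy.2⟩ hy.1
      simp only [Pi.neg_apply]
      linarith
    · filter_upwards [hk.toCLM_apply_ae_eq u, hI] with x hx hxI
      rw [hx, integral_firstOrderKernel hxI]
  · rw [hk.adjoint_toCLM]
    -- For `-p` the primitive is `-P`, and the integral of `exp(P) v` starts at the left endpoint,
    -- where `exp(P)` stays bounded.
    refine isFirstOrderPair_iff (K := fun v => -hk.adjoint.toCLM _ v) hP.neg hL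
      (hP.not_memLp_exp_neg hL hC hp0) fun u => ⟨_, isPrimitive_setIntegral_left fun c hc => ?_, ?_⟩
    · simp only [Pi.neg_apply, neg_neg]
      refine integrableOn_exp_mul hP u (Ioo_subset_Ioo_right hc.2.le) measurableSet_Ioo
        (D := C * L + P c) fun y hy => ?_
      linarith [hP.sub_le hpC hC ⟨hy.1, hy.2.trans hc.2⟩ hc hy.2]
    · filter_upwards [hk.adjoint.toCLM_apply_ae_eq u, hI,
        Lp.coeFn_neg (hk.adjoint.toCLM (measureI L) u)] with x hx hxI e
      rw [e, Pi.neg_apply, hx, integral_adjoint_firstOrderKernel hxI]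
      simp

end KerrDeSitter

/-! ### Multiplication by a bounded real function. -/

section MultiplicationOperator

variable {α : Type*} [MeasurableSpace α] {μ : Measure α} {d : α → ℝ} {C : ℝ}

theorem memLp_ofReal_mul (hd : AEStronglyMeasurable d μ) (hC : ∀ᵐ x ∂μ, ‖d x‖ ≤ C) (u : Lp ℂ 2 μ) :
    MemLp (fun x => (d x : ℂ) * u x) 2 μ := by
  refine (Lp.memLp u).of_le_mul (c := C)
    ((Complex.continuous_ofReal.comp_aestronglyMeasurable hd).mul (Lp.aestronglyMeasurable u)) ?_
  filter_upwards [hC] with x hx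
  rw [norm_mul, Complex.norm_real]
  gcongr

/-- Multiplication by a bounded real function in `L²`. -/
def mulRealCLM (hd : AEStronglyMeasurable d μ) (hC : ∀ᵐ x ∂μ, ‖d x‖ ≤ C) :
    Lp ℂ 2 μ →L[ℂ] Lp ℂ 2 μ :=
  LinearMap.mkContinuous
    { toFun := fun u => (memLp_ofReal_mul hd hC u).toLp
      map_add' := fun u v => by
        rw [← MemLp.toLp_add]
        refine MemLp.toLp_congr _ _ ?_
        filter_upwards [Lp.coeFn_add u v] with x hx
        simp only [hx, Pi.add_apply, mul_add]
      map_smul' := fun c u => by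
        rw [RingHom.id_apply, ← MemLp.toLp_const_smul]
        refine MemLp.toLp_congr _ _ ?_
        filter_upwards [Lp.coeFn_smul c u] with x hx
        simp only [hx, Pi.smul_apply, smul_eq_mul]
        ring }
    C fun u => by
    refine Lp.norm_le_mul_norm_of_ae_le_mul ?_
    filter_upwards [(memLp_ofReal_mul hd hC u).coeFn_toLp, hC] with x hx hxC
    refine (congrArg norm hx).le.trans ?_
    rw [norm_mul, Complex.norm_real]
    gcongr

theorem mulRealCLM_ae_eq (hd : AEStronglyMeasurable d μ) (hC : ∀ᵐ x ∂μ, ‖d x‖ ≤ C)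
    (u : Lp ℂ 2 μ) : mulRealCLM hd hC u =ᵐ[μ] fun x => (d x : ℂ) * u x :=
  (memLp_ofReal_mul hd hC u).coeFn_toLp

theorem isSelfAdjoint_mulRealCLM (hd : AEStronglyMeasurable d μ) (hC : ∀ᵐ x ∂μ, ‖d x‖ ≤ C) :
    IsSelfAdjoint (mulRealCLM hd hC) := by
  rw [ContinuousLinearMap.isSelfAdjoint_iff_isSymmetric]
  intro u v
  change inner ℂ (mulRealCLM hd hC u) v = inner ℂ u (mulRealCLM hd hC v)
  rw [L2.inner_def, L2.inner_def]
  refine integral_congr_ae ?_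
  filter_upwards [mulRealCLM_ae_eq hd hC u, mulRealCLM_ae_eq hd hC v] with x h1 h2
  rw [h1, h2, RCLike.inner_apply, RCLike.inner_apply, map_mul]
  simp only [Complex.conj_ofReal]
  ring

end MultiplicationOperator

/-! ### Block operators on `E × E`. -/

section BlockOperator

variable {E : Type*} [NormedAddCommGroup E] [InnerProductSpace ℂ E]

/-- The block operator `(a, b) ↦ (X b, Y a)`. -/
def offDiagonalBlock (X Y : E →L[ℂ] E) : WithLp 2 (E × E) →L[ℂ] WithLp 2 (E × E) :=
  (WithLp.prodContinuousLinearEquiv 2 ℂ E E).symm.toContinuousLinearMap ∘L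
    (ContinuousLinearMap.inl ℂ E E ∘L X ∘L WithLp.sndL 2 ℂ E E +
      ContinuousLinearMap.inr ℂ E E ∘L Y ∘L WithLp.fstL 2 ℂ E E)

/-- The block operator `(a, b) ↦ (X a, Y b)`. -/
def diagonalBlock (X Y : E →L[ℂ] E) : WithLp 2 (E × E) →L[ℂ] WithLp 2 (E × E) :=
  (WithLp.prodContinuousLinearEquiv 2 ℂ E E).symm.toContinuousLinearMap ∘L
    ((X ∘L WithLp.fstL 2 ℂ E E).prod (Y ∘L WithLp.sndL 2 ℂ E E))

@[simp] theorem offDiagonalBlock_fst (X Y : E →L[ℂ] E) (w : WithLp 2 (E × E)) :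
    (offDiagonalBlock X Y w).fst = X w.snd := by simp [offDiagonalBlock]

@[simp] theorem offDiagonalBlock_snd (X Y : E →L[ℂ] E) (w : WithLp 2 (E × E)) :
    (offDiagonalBlock X Y w).snd = Y w.fst := by simp [offDiagonalBlock]

@[simp] theorem diagonalBlock_fst (X Y : E →L[ℂ] E) (w : WithLp 2 (E × E)) :
    (diagonalBlock X Y w).fst = X w.fst := by simp [diagonalBlock]

@[simp] theorem diagonalBlock_snd (X Y : E →L[ℂ] E) (w : WithLp 2 (E × E)) :
    (diagonalBlock X Y w).snd = Y w.snd := by simp [diagonalBlock]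

theorem isCompactOperator_offDiagonalBlock {X Y : E →L[ℂ] E} (hX : IsCompactOperator X)
    (hY : IsCompactOperator Y) : IsCompactOperator (offDiagonalBlock X Y) := by
  have h1 := (hX.comp_clm (WithLp.sndL 2 ℂ E E)).clm_comp (ContinuousLinearMap.inl ℂ E E)
  have h2 := (hY.comp_clm (WithLp.fstL 2 ℂ E E)).clm_comp (ContinuousLinearMap.inr ℂ E E)
  exact (h1.add h2).clm_comp
    (WithLp.prodContinuousLinearEquiv 2 ℂ E E).symm.toContinuousLinearMap

variable [CompleteSpace E]

theorem isSelfAdjoint_offDiagonalBlock (X : E →L[ℂ] E) :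
    IsSelfAdjoint (offDiagonalBlock (ContinuousLinearMap.adjoint X) X) := by
  rw [ContinuousLinearMap.isSelfAdjoint_iff_isSymmetric]
  intro u v
  change inner ℂ (offDiagonalBlock _ X u) v = inner ℂ u (offDiagonalBlock _ X v)
  simp only [WithLp.prod_inner_apply, WithLp.ofLp_fst, WithLp.ofLp_snd, offDiagonalBlock_fst,
    offDiagonalBlock_snd, ContinuousLinearMap.adjoint_inner_left,
    ContinuousLinearMap.adjoint_inner_right]
  exact add_comm _ _

theorem isSelfAdjoint_diagonalBlock {X Y : E →L[ℂ] E} (hX : IsSelfAdjoint X)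
    (hY : IsSelfAdjoint Y) : IsSelfAdjoint (diagonalBlock X Y) := by
  rw [ContinuousLinearMap.isSelfAdjoint_iff_isSymmetric]
  intro u v
  change inner ℂ (diagonalBlock X Y u) v = inner ℂ u (diagonalBlock X Y v)
  have hX' : ∀ x y : E, inner ℂ (X x) y = inner ℂ x (X y) := hX.isSymmetric
  have hY' : ∀ x y : E, inner ℂ (Y x) y = inner ℂ x (Y y) := hY.isSymmetric
  simp only [WithLp.prod_inner_apply, WithLp.ofLp_fst, WithLp.ofLp_snd, diagonalBlock_fst,
    diagonalBlock_snd, hX', hY']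

end BlockOperator

/-! ### Bounds on the angular coefficients, and the decoupling of the system. -/

namespace KerrDeSitter

variable {Λ : ℝ}

theorem sig_nonneg (hΛ : 0 < Λ) (a : ℝ) : 0 ≤ sig Λ a := by
  unfold sig; positivity

theorem one_le_Xi (hΛ : 0 < Λ) (a : ℝ) : 1 ≤ Xi Λ a := by
  unfold Xi; linarith [sig_nonneg hΛ a]

theorem Delta_le_Xi (hΛ : 0 < Λ) (a θ : ℝ) : Delta Λ a θ ≤ Xi Λ a := by
  unfold Delta Xi
  nlinarith [sig_nonneg hΛ a, Real.cos_sq_le_one θ]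

theorem one_le_Delta (hΛ : 0 < Λ) (a θ : ℝ) : 1 ≤ Delta Λ a θ := by
  unfold Delta
  nlinarith [mul_nonneg (sig_nonneg hΛ a) (sq_nonneg (Real.cos θ))]

theorem xOf_zero (Λ a : ℝ) : xOf Λ a 0 = 0 := by simp [xOf]

theorem len_pos (hΛ : 0 < Λ) (a : ℝ) : 0 < len Λ a := by
  rw [← xOf_zero Λ a]
  exact strictMono_xOf hΛ a Real.pi_pos

/-- Integrated form of `1/√Δ ≥ 1/√Ξ`; it turns distances in `θ` to the poles into distances in `x`.
-/
theorem sub_le_sqrt_Xi_mul (hΛ : 0 < Λ) (a : ℝ) {θ θ' : ℝ} (h : θ ≤ θ') :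
    θ' - θ ≤ Real.sqrt (Xi Λ a) * (xOf Λ a θ' - xOf Λ a θ) := by
  have hd : ∀ t, HasDerivAt (fun t => Real.sqrt (Xi Λ a) * xOf Λ a t - t)
      (Real.sqrt (Xi Λ a) * (1 / Real.sqrt (Delta Λ a t)) - 1) t := fun t =>
    ((hasDerivAt_xOf hΛ a t).const_mul _).sub (hasDerivAt_id t)
  have hm : Monotone fun t => Real.sqrt (Xi Λ a) * xOf Λ a t - t := by
    refine monotone_of_deriv_nonneg (fun t => (hd t).differentiableAt) fun t => ?_
    rw [(hd t).deriv, mul_one_div, sub_nonneg, one_le_div (Real.sqrt_pos.2 (Delta_pos hΛ a t))]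
    exact Real.sqrt_le_sqrt (Delta_le_Xi hΛ a t)
  have := hm h
  simp only at this
  linarith

theorem angle_mem_Ioo (hΛ : 0 < Λ) (a : ℝ) {x : ℝ} (hx : x ∈ Ioo 0 (len Λ a)) :
    angle Λ a x ∈ Ioo 0 Real.pi ∧ xOf Λ a (angle Λ a x) = x := by
  have h := (angle_spec hΛ a (Ioo_subset_Icc_self hx)).2
  refine ⟨⟨(strictMono_xOf hΛ a).lt_iff_lt.1 ?_, (strictMono_xOf hΛ a).lt_iff_lt.1 ?_⟩, h⟩
  · rw [h, xOf_zero]; exact hx.1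
  · rw [h]; exact hx.2

theorem continuousOn_angle (hΛ : 0 < Λ) (a : ℝ) :
    ContinuousOn (angle Λ a) (Ioo 0 (len Λ a)) := by
  intro x hx
  have hmono := strictMono_xOf hΛ a
  have hI : ∀ᶠ y in 𝓝[Ioo 0 (len Λ a)] x, xOf Λ a (angle Λ a y) = y := by
    filter_upwards [self_mem_nhdsWithin] with y hy using (angle_mem_Ioo hΛ a hy).2
  have hx' := (angle_mem_Ioo hΛ a hx).2
  refine tendsto_order.2 ⟨fun θ hθ => ?_, fun θ hθ => ?_⟩
  · have h1 : xOf Λ a θ < x := by rw [← hx']; exact hmono hθ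
    filter_upwards [hI, mem_nhdsWithin_of_mem_nhds (Ioi_mem_nhds h1)] with y hy hy'
    exact hmono.lt_iff_lt.1 (by rw [hy]; exact hy')
  · have h1 : x < xOf Λ a θ := by rw [← hx']; exact hmono hθ
    filter_upwards [hI, mem_nhdsWithin_of_mem_nhds (Iio_mem_nhds h1)] with y hy hy'
    exact hmono.lt_iff_lt.1 (by rw [hy]; exact hy')

theorem sin_angle_pos (hΛ : 0 < Λ) (a : ℝ) {x : ℝ} (hx : x ∈ Ioo 0 (len Λ a)) :
    0 < Real.sin (angle Λ a x) :=
  Real.sin_pos_of_mem_Ioo (angle_mem_Ioo hΛ a hx).1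

theorem continuousOn_diag (hΛ : 0 < Λ) (a m : ℝ) :
    ContinuousOn (diag Λ a m) (Ioo 0 (len Λ a)) :=
  continuousOn_const.mul (Real.continuous_cos.comp_continuousOn (continuousOn_angle hΛ a))

theorem abs_diag_le (Λ a m x : ℝ) : ‖diag Λ a m x‖ ≤ |a * m| := by
  rw [diag, Real.norm_eq_abs, abs_mul]
  exact mul_le_of_le_one_right (abs_nonneg _) (Real.abs_cos_le_one _)

theorem continuousOn_offDiag (hΛ : 0 < Λ) (a ω k : ℝ) :
    ContinuousOn (offDiag Λ a ω k) (Ioo 0 (len Λ a)) := by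
  have hθ := continuousOn_angle hΛ a
  have hsin := Real.continuous_sin.comp_continuousOn hθ
  have hD : Continuous (Delta Λ a) := by unfold Delta; fun_prop
  refine (continuousOn_const.div (Real.continuous_sqrt.comp_continuousOn
    (hD.comp_continuousOn hθ)) fun x _ => (Real.sqrt_pos.2 (Delta_pos hΛ a _)).ne').mul
    ((continuousOn_const.mul hsin).add
      (continuousOn_const.div hsin fun x hx => (sin_angle_pos hΛ a hx).ne'))

/-- The map `k ↦ -k - 1` is `k̂ ↦ -k̂`; it exchanges `k ≤ -1` with `k ≥ 0`. -/
theorem offDiag_neg (Λ a ω k : ℝ) : offDiag Λ a (-ω) (-k - 1) = -offDiag Λ a ω k := by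
  ext x
  simp only [offDiag, Pi.neg_apply]
  ring

/-- Lower bound of the off-diagonal coefficient in terms of a distance `t` to an endpoint. -/
theorem offDiag_ge (hΛ : 0 < Λ) (a ω : ℝ) {k : ℝ} (hk : 0 ≤ k) {x t : ℝ}
    (hx : x ∈ Ioo 0 (len Λ a)) (ht : 0 < t)
    (hsin : Real.sin (angle Λ a x) ≤ Real.sqrt (Xi Λ a) * t) :
    1 / (2 * t) - Xi Λ a * |a * ω| ≤ offDiag Λ a ω k x := by
  set θ := angle Λ a x with hθ
  have hs : 0 < Real.sin θ := sin_angle_pos hΛ a hx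
  have hX : 1 ≤ Xi Λ a := one_le_Xi hΛ a
  have hsX : 0 ≤ Real.sqrt (Xi Λ a) := Real.sqrt_nonneg _
  have hr : 1 ≤ Real.sqrt (Delta Λ a θ) := Real.one_le_sqrt.2 (one_le_Delta hΛ a θ)
  have hr' : Real.sqrt (Delta Λ a θ) ≤ Real.sqrt (Xi Λ a) :=
    Real.sqrt_le_sqrt (Delta_le_Xi hΛ a θ)
  have hr0 : 0 < Real.sqrt (Delta Λ a θ) := one_pos.trans_le hr
  have e : offDiag Λ a ω k x = Xi Λ a / Real.sqrt (Delta Λ a θ) * (a * ω * Real.sin θ) +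
      (k + 1 / 2) * (Xi Λ a / (Real.sqrt (Delta Λ a θ) * Real.sin θ)) := by
    rw [offDiag, ← hθ]
    field_simp
  have h1 : -(Xi Λ a * |a * ω|) ≤ Xi Λ a / Real.sqrt (Delta Λ a θ) * (a * ω * Real.sin θ) := by
    refine neg_le_of_abs_le ?_
    rw [abs_mul, abs_mul (a * ω), abs_of_pos hs, abs_of_pos (div_pos (by linarith) hr0)]
    refine mul_le_mul (div_le_self (by linarith) hr)
      (mul_le_of_le_one_right (abs_nonneg _) (Real.sin_le_one θ)) (by positivity) (by linarith)
  -- Here `√Δ sin θ ≤ √Ξ · √Ξ t = Ξ t`, so the factor `Ξ` cancels exactly; `k + 1/2 ≥ 1/2` then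
  -- gives the constant `1/2` needed for failure of square integrability.
  have h2 : 1 / t ≤ Xi Λ a / (Real.sqrt (Delta Λ a θ) * Real.sin θ) := by
    rw [div_le_div_iff₀ ht (by positivity), one_mul]
    calc _ ≤ Real.sqrt (Xi Λ a) * (Real.sqrt (Xi Λ a) * t) := by gcongr
      _ = Xi Λ a * t := by rw [← mul_assoc, Real.mul_self_sqrt (by linarith)]
  have h3 : 0 < 1 / t := one_div_pos.2 ht
  have h4 : 1 / (2 * t) = 1 / 2 * (1 / t) := by field_simp
  rw [e, h4]
  nlinarith [mul_nonneg hk (h3.le.trans h2)]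

theorem sin_angle_le (hΛ : 0 < Λ) (a : ℝ) {x : ℝ} (hx : x ∈ Ioo 0 (len Λ a)) :
    Real.sin (angle Λ a x) ≤ Real.sqrt (Xi Λ a) * x := by
  obtain ⟨hθ, e⟩ := angle_mem_Ioo hΛ a hx
  have := sub_le_sqrt_Xi_mul hΛ a hθ.1.le
  rw [e, xOf_zero] at this
  linarith [Real.sin_le hθ.1.le]

theorem sin_angle_le_sub (hΛ : 0 < Λ) (a : ℝ) {x : ℝ} (hx : x ∈ Ioo 0 (len Λ a)) :
    Real.sin (angle Λ a x) ≤ Real.sqrt (Xi Λ a) * (len Λ a - x) := by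
  obtain ⟨hθ, e⟩ := angle_mem_Ioo hΛ a hx
  have := sub_le_sqrt_Xi_mul hΛ a hθ.2.le
  rw [e] at this
  rw [← Real.sin_pi_sub]
  exact (Real.sin_le (sub_nonneg.2 hθ.2.le)).trans this

theorem exists_offDiag_inverse_of_nonneg (hΛ : 0 < Λ) (a ω : ℝ) {k : ℝ} (hk : 0 ≤ k) :
    ∃ K : Lp ℂ 2 (measureI (len Λ a)) →L[ℂ] Lp ℂ 2 (measureI (len Λ a)), IsCompactOperator K ∧
      IsCompactOperator (ContinuousLinearMap.adjoint K) ∧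
      (∀ g u, IsFirstOrderPair (len Λ a) (offDiag Λ a ω k) g u ↔ g = K u) ∧
      ∀ f v, IsFirstOrderPair (len Λ a) (-offDiag Λ a ω k) f v ↔
        f = -ContinuousLinearMap.adjoint K v :=
  exists_compact_inverse (len_pos hΛ a) (continuousOn_offDiag hΛ a ω k)
    (mul_nonneg (zero_le_one.trans (one_le_Xi hΛ a)) (abs_nonneg (a * ω)))
    (fun _ hx => offDiag_ge hΛ a ω hk hx hx.1 (sin_angle_le hΛ a hx))
    fun _ hx => offDiag_ge hΛ a ω hk hx (sub_pos.2 hx.2) (sin_angle_le_sub hΛ a hx)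

theorem exists_offDiag_inverse (hΛ : 0 < Λ) (a ω : ℝ) {k : ℝ} (hk : k ∉ Ioo (-1 : ℝ) 0) :
    ∃ K : Lp ℂ 2 (measureI (len Λ a)) →L[ℂ] Lp ℂ 2 (measureI (len Λ a)), IsCompactOperator K ∧
      IsCompactOperator (ContinuousLinearMap.adjoint K) ∧
      (∀ g u, IsFirstOrderPair (len Λ a) (offDiag Λ a ω k) g u ↔ g = K u) ∧
      ∀ f v, IsFirstOrderPair (len Λ a) (-offDiag Λ a ω k) f v ↔
        f = -ContinuousLinearMap.adjoint K v := by
  rcases le_or_gt 0 k with h | h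
  · exact exists_offDiag_inverse_of_nonneg hΛ a ω h
  · have hk1 : 0 ≤ -k - 1 := by
      by_contra h1
      exact hk ⟨by linarith, h⟩
    -- With the sign of the coefficient reversed, the two scalar equations trade places, so `-K†`
    -- takes over the role of `K`, and its negative adjoint is `K` again.
    obtain ⟨K, h1, h2, h3, h4⟩ := exists_offDiag_inverse_of_nonneg hΛ a (-ω) hk1
    rw [offDiag_neg] at h3 h4
    rw [neg_neg] at h4
    refine ⟨-ContinuousLinearMap.adjoint K, h2.neg, ?_, fun g u => by simpa using h4 g u,
      fun f v => ?_⟩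
    · rw [map_neg, ContinuousLinearMap.adjoint_adjoint]
      exact h1.neg
    · rw [h3, map_neg, ContinuousLinearMap.adjoint_adjoint, neg_apply, neg_neg]

/-- The angular operator decouples into two first order scalar equations. -/
theorem isAngularPair_iff {a m ω k C : ℝ}
    (hd : AEStronglyMeasurable (diag Λ a m) (measureI (len Λ a)))
    (hC : ∀ᵐ x ∂measureI (len Λ a), ‖diag Λ a m x‖ ≤ C) (S T : L2Pair (len Λ a)) :
    IsAngularPair Λ a m ω k S T ↔
      IsFirstOrderPair (len Λ a) (offDiag Λ a ω k) S.snd (T.fst + mulRealCLM hd hC S.fst) ∧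
      IsFirstOrderPair (len Λ a) (-offDiag Λ a ω k) S.fst (-(T.snd - mulRealCLM hd hC S.snd)) := by
  have e1 := Lp.coeFn_add T.fst (mulRealCLM hd hC S.fst)
  have e2 := Lp.coeFn_neg (T.snd - mulRealCLM hd hC S.snd)
  have e3 := Lp.coeFn_sub T.snd (mulRealCLM hd hC S.snd)
  have d1 := mulRealCLM_ae_eq hd hC S.fst
  have d2 := mulRealCLM_ae_eq hd hC S.snd
  constructor
  · rintro ⟨f, g, hf, hg, hSf, hSg, hT1, hT2⟩
    refine ⟨⟨g, hg, hSg, ?_⟩, ⟨f, hf, hSf, ?_⟩⟩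
    · filter_upwards [e1, d1, hSf, hT1] with x e1 d1 hSf hT1
      rw [e1, Pi.add_apply, hT1, d1, hSf, formal₁]
      ring
    · filter_upwards [e2, e3, d2, hSg, hT2] with x e2 e3 d2 hSg hT2
      rw [e2, Pi.neg_apply, e3, Pi.sub_apply, hT2, d2, hSg, formal₂, Pi.neg_apply]
      push_cast
      ring
  · rintro ⟨⟨g, hg, hSg, h1⟩, ⟨f, hf, hSf, h2⟩⟩
    refine ⟨f, g, hf, hg, hSf, hSg, ?_, ?_⟩
    · filter_upwards [e1, d1, hSf, h1] with x e1 d1 hSf h1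
      rw [e1, Pi.add_apply, d1, hSf] at h1
      rw [formal₁]
      linear_combination h1
    · filter_upwards [e2, e3, d2, hSg, h2] with x e2 e3 d2 hSg h2
      rw [e2, Pi.neg_apply, e3, Pi.sub_apply, d2, hSg, Pi.neg_apply] at h2
      rw [formal₂]
      push_cast at h2
      linear_combination -h2

/-- The angular operator is a bounded perturbation of an operator with compact inverse. -/
theorem exists_isPerturbedInverse_angularOperator (hΛ : 0 < Λ) (a m ω : ℝ) {k : ℝ}
    (hk : k ∉ Ioo (-1 : ℝ) 0) :
    ∃ R B : L2Pair (len Λ a) →L[ℂ] L2Pair (len Λ a), IsCompactOperator R ∧ IsSelfAdjoint R ∧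
      IsSelfAdjoint B ∧
      UnboundedOperator.IsPerturbedInverse (angularOperator Λ a m ω k) R B := by
  obtain ⟨K, hK, hK', h1, h2⟩ := exists_offDiag_inverse hΛ a ω hk
  have hd : AEStronglyMeasurable (diag Λ a m) (measureI (len Λ a)) :=
    (continuousOn_diag hΛ a m).aestronglyMeasurable measurableSet_Ioo
  have hC : ∀ᵐ x ∂measureI (len Λ a), ‖diag Λ a m x‖ ≤ |a * m| :=
    Eventually.of_forall (abs_diag_le Λ a m)
  have hD := isSelfAdjoint_mulRealCLM hd hC
  -- The signs in `f = -K† (-(T₂ - d g))` cancel. With `B = diag(-d, d)`, the two scalar equations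
  -- read `S = R (T - B S)`.
  refine ⟨offDiagonalBlock (ContinuousLinearMap.adjoint K) K,
    diagonalBlock (-mulRealCLM hd hC) (mulRealCLM hd hC),
    isCompactOperator_offDiagonalBlock hK' hK, isSelfAdjoint_offDiagonalBlock K,
    isSelfAdjoint_diagonalBlock hD.neg hD, fun S T => ?_⟩
  rw [angularOperator_graph]
  change IsAngularPair Λ a m ω k S T ↔ _
  rw [isAngularPair_iff hd hC, h1, h2, map_neg, neg_neg]
  constructor
  · rintro ⟨hg, hf⟩
    refine WithLp.ofLp_injective 2 (Prod.ext ?_ ?_)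
    · simpa using hf
    · simpa using hg
  · intro h
    exact ⟨by simpa using congrArg WithLp.snd h, by simpa using congrArg WithLp.fst h⟩

end KerrDeSitter

theorem mainTheorem3 (Λ a m ω k : ℝ) (hΛ : 0 < Λ) (hk : k ∉ Set.Ioo (-1 : ℝ) 0) :
    IsSelfAdjoint (KerrDeSitter.angularOperator Λ a m ω k) ∧
    UnboundedOperator.HasCompactResolvent (KerrDeSitter.angularOperator Λ a m ω k) ∧
    (∀ z ∈ UnboundedOperator.spectrum (KerrDeSitter.angularOperator Λ a m ω k),
      UnboundedOperator.IsEigenvalue (KerrDeSitter.angularOperator Λ a m ω k) z ∧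
      ∃ U ∈ nhds z,
        U ∩ UnboundedOperator.spectrum (KerrDeSitter.angularOperator Λ a m ω k) = {z}) ∧
    ∀ z : ℂ, ¬ AccPt z (Filter.principal
      (UnboundedOperator.spectrum (KerrDeSitter.angularOperator Λ a m ω k))) := by
  obtain ⟨R, B, hRc, hR, hB, h⟩ :=
    KerrDeSitter.exists_isPerturbedInverse_angularOperator hΛ a m ω hk
  exact ⟨h.isSelfAdjoint hR hB, h.hasCompactResolvent hRc hR hB,
    fun z hz => ⟨(h.mem_spectrum_iff hRc z).1 hz, h.exists_nhds_inter_spectrum hRc hR hB hz⟩,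
    h.not_accPt_spectrum hRc hR hB⟩

end
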